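/- Let $d\ge 1$, let $(\Omega,\mathcal F,\mathbb P)$ be a probability space with a non-decreasing sequence of $\sigma$-algebras $\{\mathcal F_k\}_{k\ge0}$, write $\mathbb E_k[\cdot]=\mathbb E[\cdot\mid\mathcal F_k]$, and consider the saturated model $$y_{k+1}=S_k(\phi_k^{\mathrm T}\theta+\varepsilon_{k+1}),\qquad k\ge 0,\qquad S_k(x)=\begin{cases}L_k,&x<l_k,\\ x,&l_k\le x\le u_k,\\ U_k,&x>u_k.\end{cases}$$ **Assumptions.** (1) $\phi_k\in\mathbb R^d$ is $\mathcal F_k$-measurable and $\{\phi_k\}$ is a.s. bounded in $k$; $\theta$ is an interior point of a convex compact set $D\subseteq\mathbb R^d$; $C_k$ are $\mathcal F_k$-measurable random variables and $C$ a constant with $\sup_{x\in D}|\phi_k^{\mathrm T}x|\le C_k\le C$ for all $k$, a.s. (2) $l_k,u_k,L_k,U_k,b_k$ are $\mathcal F_k$-measurable; a.s., for all $k$, $L_k\le l_k\le u_k\le U_k$ and $L_k=l_k=u_k=U_k$ does not hold; there is a constant $M>0$ with $\sup_{k}\max\{l_k,-u_k\}\le M$ a.s.; and $0<\inf_k b_k\le\sup_k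 b_k\le 1$ a.s. (3) Given $\mathcal F_k$, the noise $\varepsilon_{k+1}$ has a continuous conditional density $f_{k+1}$ (a regular version, a probability density for every sample point), with conditional distribution function $F_{k+1}(x)=\int_{-\infty}^x f_{k+1}(t)\,dt$ satisfying $F_{k+1}(0)=\tfrac12$, and a.s. $$0<\inf_{|x|\le\max\{2C,C+M\},\,k\ge0}f_{k+1}(x)\le\sup_{|x|\le\max\{2C,C+M\},\,k\ge0}f_{k+1}(x)<\infty .$$ (4) The saturation function is continuous: a.s. $l_k=L_k$ and $u_k=U_k$ for all $k$. (5) $\{\varepsilon_k,\mathcal F_k\}_{k\ge0}$ is a martingale difference sequence, and for some $r>4$, $\sup_{k\ge0}\mathbb E_k[|\varepsilon_{k+1}|^r]<\infty$ a.s. **Algorithm.** Let $\bar\mu_k,\mu_k$ be positive $\mathcal F_k$-measurable random variables, each sequence a.s. bounded and bounded away from $0$ in $k$. For a positive definite $Q$ let $\|x\|_Q^2=x^{\mathrm T}Qx$ and $\Pi_Q(x)=\arg\min_{y\in D}\|x-y\|_Q$. Let $\bar\theta_0,\theta_0$ be $\mathcal F_0$-measurable with values in $D$, and $\bar P_0,P_0$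 be $\mathcal F_0$-measurable positive definite matrices. For an estimate $\vartheta$ put $$v_{k+1}(\vartheta)=\operatorname{sgn}[y_{k+1}-S_k(\phi_k^{\mathrm T}\vartheta)]+F_{k+1}(u_k-\phi_k^{\mathrm T}\vartheta)\,\mathrm I_{[S_k(\phi_k^{\mathrm T}\vartheta)=U_k]}-[1-F_{k+1}(l_k-\phi_k^{\mathrm T}\vartheta)]\,\mathrm I_{[S_k(\phi_k^{\mathrm T}\vartheta)=L_k]} .$$ The preliminary estimates are given by $$\bar\beta_k=\inf_{|x|\le\max\{2C_k,\,C_k+l_k,\,C_k-u_k\}}f_{k+1}(x),\qquad \bar a_k=\frac1{\bar\mu_k+\bar\beta_kb_k^2\phi_k^{\mathrm T}\bar P_k\phi_k},$$ $$\bar P_{k+1}=\bar P_k-\bar a_k\bar\beta_kb_k^2\bar P_k\phi_k\phi_k^{\mathrm T}\bar P_k,\qquad \bar\theta_{k+1}=\Pi_{\bar P_{k+1}^{-1}}\{\bar\theta_k+\bar a_kb_k\bar P_k\phi_k\,v_{k+1}(\bar\theta_k)\}.$$ The accelerated estimates are given by the same recursion without bars, $$a_k=\frac1{\mu_k+\beta_kb_k^2\phi_k^{\mathrm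 T}P_k\phi_k},\quad P_{k+1}=P_k-a_k\beta_kb_k^2P_k\phi_k\phi_k^{\mathrm T}P_k,\quad \theta_{k+1}=\Pi_{P_{k+1}^{-1}}\{\theta_k+a_kb_kP_k\phi_k\,v_{k+1}(\theta_k)\},$$ where, with $d_k=\phi_k^{\mathrm T}(\bar\theta_k-\theta_k)$, the gain $\beta_k$ is $$\beta_k=\begin{cases}\dfrac{F_{k+1}(l_k-\phi_k^{\mathrm T}\theta_k)-F_{k+1}(l_k-\phi_k^{\mathrm T}\bar\theta_k)}{d_k}\ \ (d_k\ne0),\qquad f_{k+1}(l_k-\phi_k^{\mathrm T}\theta_k)\ \ (d_k=0),&\text{if }S_k(\phi_k^{\mathrm T}\theta_k)=L_k,\\[2mm]\dfrac{1-2F_{k+1}(\phi_k^{\mathrm T}\theta_k-\phi_k^{\mathrm T}\bar\theta_k)}{d_k}\ \ (d_k\ne0),\qquad 2f_{k+1}(0)\ \ (d_k=0),&\text{if }L_k<S_k(\phi_k^{\mathrm T}\theta_k)<U_k,\\[2mm]\dfrac{F_{k+1}(u_k-\phi_k^{\mathrm T}\theta_k)-F_{k+1}(u_k-\phi_k^{\mathrm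 T}\bar\theta_k)}{d_k}\ \ (d_k\ne0),\qquad f_{k+1}(u_k-\phi_k^{\mathrm T}\theta_k)\ \ (d_k=0),&\text{if }S_k(\phi_k^{\mathrm T}\theta_k)=U_k.\end{cases}$$ The adaptive predictor is $\hat y_{k+1}=S_k(\phi_k^{\mathrm T}\theta_k)$. **Conclusion.** With $\sigma_k^2=\mathbb E_k[\varepsilon_{k+1}^2]$, the averaged weighted prediction error $E_n=\frac1n\sum_{k=0}^{n-1}b_k|y_{k+1}-\hat y_{k+1}|$ satisfies, as $n\to\infty$, $$E_n\le\sqrt{\frac{\sum_{k=0}^{n-1}b_k^2\sigma_k^2}{n}}+O\!\left(\sqrt[4]{\frac{\log\log n}{n}}\right)\quad\text{a.s.}$$ (the constant in $O(\cdot)$ may depend on the sample point). -/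

import Mathlib

open MeasureTheory Set Filter Matrix

noncomputable section

/-- The saturation function with observable range `[l, u]` and saturated outputs `L`, `U`. -/
def saturate (L l u U x : ℝ) : ℝ :=
  if x < l then L else if x ≤ u then x else U

/-- The distribution function with density `g`. -/
def cdfOf (g : ℝ → ℝ) (x : ℝ) : ℝ := ∫ t in Iic x, g t

/-- The norm `‖x‖_Q = (xᵀ Q x)^{1/2}` attached to a positive definite matrix `Q`. -/
def weightedNorm {d : ℕ} (Q : Matrix (Fin d) (Fin d) ℝ) (x : Fin d → ℝ) : ℝ :=
  Real.sqrt (x ⬝ᵥ (Q *ᵥ x))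

/-- `z` is the projection of `x` onto `D` in the norm `‖·‖_Q`, that is, `z` minimizes
`‖x - y‖_Q` over `y ∈ D` (unique when `Q` is positive definite, `D` convex and compact). -/
def IsWeightedProj {d : ℕ} (D : Set (Fin d → ℝ)) (Q : Matrix (Fin d) (Fin d) ℝ)
    (x z : Fin d → ℝ) : Prop :=
  z ∈ D ∧ ∀ y ∈ D, weightedNorm Q (x - z) ≤ weightedNorm Q (x - y)

/-- The corrected sign innovation. Here `y` is the new observation, `s = φᵀϑ` for the current
estimate `ϑ`, and `g` is the conditional density of the noise. -/
def signInnovation (g : ℝ → ℝ) (L l u U y s : ℝ) : ℝ :=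
  Real.sign (y - saturate L l u U s)
    + (if saturate L l u U s = U then cdfOf g (u - s) else 0)
    - (if saturate L l u U s = L then 1 - cdfOf g (l - s) else 0)

/-- The adaptation gain of the preliminary step: the infimum of the conditional density `g` over
`|x| ≤ max {2c, c + l, c - u}`. -/
def prelimBeta (g : ℝ → ℝ) (l u c : ℝ) : ℝ :=
  sInf (g '' {x : ℝ | |x| ≤ max (2 * c) (max (c + l) (c - u))})

/-- The adaptation gain of the accelerated step. Here `s = φᵀθ_k` for the current accelerated
estimate, `sBar = φᵀθ̄_k` for the current preliminary one, and `sBar - s` is `d_k`. The last branch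
is the case `L < S(s) < U`, because `L ≤ S(s) ≤ U`. -/
def accelBeta (g : ℝ → ℝ) (L l u U s sBar : ℝ) : ℝ :=
  if saturate L l u U s = L then
    if sBar - s ≠ 0 then (cdfOf g (l - s) - cdfOf g (l - sBar)) / (sBar - s) else g (l - s)
  else if saturate L l u U s = U then
    if sBar - s ≠ 0 then (cdfOf g (u - s) - cdfOf g (u - sBar)) / (sBar - s) else g (u - s)
  else
    if sBar - s ≠ 0 then (1 - 2 * cdfOf g (s - sBar)) / (sBar - s) else 2 * g 0

/-- The scalar step size `a = 1 / (m + β b² φᵀ P φ)`. -/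
def stepSize {d : ℕ} (m β b : ℝ) (φ : Fin d → ℝ) (P : Matrix (Fin d) (Fin d) ℝ) : ℝ :=
  1 / (m + β * b ^ 2 * (φ ⬝ᵥ (P *ᵥ φ)))

/-- One recursive step from the estimate and gain matrix `(ϑ, P)` to `(ϑ', P')`, with step size
parameter `m`, adaptation gain `β`, weight `b`, regressor `φ` and innovation `v`. -/
def IsRecursiveStep {d : ℕ} (D : Set (Fin d → ℝ)) (m β b v : ℝ) (φ : Fin d → ℝ)
    (ϑ : Fin d → ℝ) (P : Matrix (Fin d) (Fin d) ℝ)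
    (ϑ' : Fin d → ℝ) (P' : Matrix (Fin d) (Fin d) ℝ) : Prop :=
  P' = P - (stepSize m β b φ P * β * b ^ 2) • (P * vecMulVec φ φ * P) ∧
  IsWeightedProj D P'⁻¹ (ϑ + (stepSize m β b φ P * b * v) • (P *ᵥ φ)) ϑ'

variable {Ω : Type*} [mΩ : MeasurableSpace Ω]

/-- `g` is a continuous regular conditional density, with median zero, of the real random
variable `X` given the sub-σ-algebra `m`. -/
structure IsMedianZeroCondDensity (Pr : Measure Ω) (m : MeasurableSpace Ω) (X : Ω → ℝ)
    (g : Ω → ℝ → ℝ) : Prop where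
  measurable : ∀ x, Measurable[m] fun ω => g ω x
  continuous : ∀ ω, Continuous (g ω)
  nonneg : ∀ ω x, 0 ≤ g ω x
  integrable : ∀ ω, Integrable (g ω)
  integral_eq_one : ∀ ω, ∫ x, g ω x = 1
  /-- `P(X ≤ x | m) = ∫_{-∞}^x g(t) dt` almost surely, for every `x`. -/
  cond_cdf : ∀ x, Pr[{ω | X ω ≤ x}.indicator (fun _ => (1 : ℝ)) | m] =ᵐ[Pr]
    fun ω => cdfOf (g ω) x
  median : ∀ ω, cdfOf (g ω) 0 = 1 / 2

/-- Regressors are adapted and bounded, the parameter is interior to the convex compact set `D`,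
and `c k` is an adapted upper bound of `sup_{x ∈ D} |φ_kᵀ x|`, itself at most the constant `C`. -/
structure RegressorConditions {d : ℕ} (Pr : Measure Ω) (F : Filtration ℕ mΩ)
    (D : Set (Fin d → ℝ)) (θ : Fin d → ℝ) (φ : ℕ → Ω → Fin d → ℝ)
    (c : ℕ → Ω → ℝ) (C : ℝ) : Prop where
  convex : Convex ℝ D
  compact : IsCompact D
  interior : θ ∈ interior D
  adapted : ∀ k, Measurable[F k] (φ k)
  bounded : ∀ᵐ ω ∂Pr, Bornology.IsBounded (range fun k => φ k ω)
  adapted_bound : ∀ k, Measurable[F k] (c k)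
  le_bound : ∀ᵐ ω ∂Pr, ∀ k, ∀ x ∈ D, |φ k ω ⬝ᵥ x| ≤ c k ω
  bound_le : ∀ᵐ ω ∂Pr, ∀ k, c k ω ≤ C

/-- Conditions on the thresholds, the saturated outputs and the weights. -/
structure ThresholdConditions (Pr : Measure Ω) (F : Filtration ℕ mΩ)
    (L l u U b : ℕ → Ω → ℝ) (M : ℝ) : Prop where
  adapted_L : ∀ k, Measurable[F k] (L k)
  adapted_l : ∀ k, Measurable[F k] (l k)
  adapted_u : ∀ k, Measurable[F k] (u k)
  adapted_U : ∀ k, Measurable[F k] (U k)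
  ordered : ∀ᵐ ω ∂Pr, ∀ k, L k ω ≤ l k ω ∧ l k ω ≤ u k ω ∧ u k ω ≤ U k ω
  M_pos : 0 < M
  le_M : ∀ᵐ ω ∂Pr, ∀ k, max (l k ω) (-u k ω) ≤ M
  nondegenerate : ∀ᵐ ω ∂Pr, ∀ k, ¬ (L k ω = l k ω ∧ l k ω = u k ω ∧ u k ω = U k ω)
  adapted_b : ∀ k, Measurable[F k] (b k)
  b_lower : ∀ᵐ ω ∂Pr, ∃ δ : ℝ, 0 < δ ∧ ∀ k, δ ≤ b k ω
  b_upper : ∀ᵐ ω ∂Pr, ∀ k, b k ω ≤ 1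

/-- Conditions on the conditional law of the noise; `f (k + 1)` is the conditional density of
`ε (k + 1)` given `F k`. -/
structure NoiseConditions (Pr : Measure Ω) (F : Filtration ℕ mΩ) (ε : ℕ → Ω → ℝ)
    (f : ℕ → Ω → ℝ → ℝ) (C M : ℝ) : Prop where
  density : ∀ k, IsMedianZeroCondDensity Pr (F k) (ε (k + 1)) (f (k + 1))
  density_bounds : ∀ᵐ ω ∂Pr, ∃ h H : ℝ, 0 < h ∧
    ∀ k x, |x| ≤ max (2 * C) (C + M) → h ≤ f (k + 1) ω x ∧ f (k + 1) ω x ≤ H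

/-- Admissible step size parameters: adapted, positive, bounded and bounded away from zero. -/
structure IsStepParameter (Pr : Measure Ω) (F : Filtration ℕ mΩ) (m : ℕ → Ω → ℝ) : Prop where
  adapted : ∀ k, Measurable[F k] (m k)
  pos : ∀ k ω, 0 < m k ω
  bounds : ∀ᵐ ω ∂Pr, ∃ δ B : ℝ, 0 < δ ∧ ∀ k, δ ≤ m k ω ∧ m k ω ≤ B

/-- Admissible initial values, known at time zero: an estimate in `D` and a positive definite
matrix. -/
structure IsInitialValue {d : ℕ} (F : Filtration ℕ mΩ) (D : Set (Fin d → ℝ))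
    (ϑ₀ : Ω → Fin d → ℝ) (P₀ : Ω → Matrix (Fin d) (Fin d) ℝ) : Prop where
  measurable_estimate : Measurable[F 0] ϑ₀
  measurable_matrix : ∀ i j, Measurable[F 0] fun ω => P₀ ω i j
  mem : ∀ ω, ϑ₀ ω ∈ D
  posDef : ∀ ω, (P₀ ω).PosDef

/-- The observations of the saturated model, `y (k + 1) = S_k(φ_kᵀθ + ε_{k+1})`. (The value at
index zero plays no role.) -/
def observation {d : ℕ} (L l u U : ℕ → Ω → ℝ) (φ : ℕ → Ω → Fin d → ℝ) (θ : Fin d → ℝ)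
    (ε : ℕ → Ω → ℝ) : ℕ → Ω → ℝ
  | 0, _ => 0
  | k + 1, ω => saturate (L k ω) (l k ω) (u k ω) (U k ω) (φ k ω ⬝ᵥ θ + ε (k + 1) ω)

/-- The predictions `ŷ (k + 1) = S_k(φ_kᵀθ_k)` based on the estimates `est k = θ_k`. (The value
at index zero plays no role.) -/
def prediction {d : ℕ} (L l u U : ℕ → Ω → ℝ) (φ : ℕ → Ω → Fin d → ℝ)
    (est : ℕ → Ω → Fin d → ℝ) : ℕ → Ω → ℝ
  | 0, _ => 0
  | k + 1, ω => saturate (L k ω) (l k ω) (u k ω) (U k ω) (φ k ω ⬝ᵥ est k ω)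

/-- The two-step weighted least absolute deviation algorithm run on the observations `y`:
`estBar`, `PBar` are the preliminary estimates and gain matrices, `est`, `P` the accelerated
ones. -/
structure IsTSWLAD {d : ℕ} (F : Filtration ℕ mΩ) (D : Set (Fin d → ℝ))
    (φ : ℕ → Ω → Fin d → ℝ) (y : ℕ → Ω → ℝ) (L l u U b c : ℕ → Ω → ℝ)
    (f : ℕ → Ω → ℝ → ℝ) (mBar m : ℕ → Ω → ℝ)
    (estBar : ℕ → Ω → Fin d → ℝ) (PBar : ℕ → Ω → Matrix (Fin d) (Fin d) ℝ)
    (est : ℕ → Ω → Fin d → ℝ) (P : ℕ → Ω → Matrix (Fin d) (Fin d) ℝ) : Prop where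
  initBar : IsInitialValue F D (estBar 0) (PBar 0)
  init : IsInitialValue F D (est 0) (P 0)
  stepBar : ∀ k ω, IsRecursiveStep D (mBar k ω)
    (prelimBeta (f (k + 1) ω) (l k ω) (u k ω) (c k ω)) (b k ω)
    (signInnovation (f (k + 1) ω) (L k ω) (l k ω) (u k ω) (U k ω) (y (k + 1) ω)
      (φ k ω ⬝ᵥ estBar k ω))
    (φ k ω) (estBar k ω) (PBar k ω) (estBar (k + 1) ω) (PBar (k + 1) ω)
  step : ∀ k ω, IsRecursiveStep D (m k ω)
    (accelBeta (f (k + 1) ω) (L k ω) (l k ω) (u k ω) (U k ω)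
      (φ k ω ⬝ᵥ est k ω) (φ k ω ⬝ᵥ estBar k ω)) (b k ω)
    (signInnovation (f (k + 1) ω) (L k ω) (l k ω) (u k ω) (U k ω) (y (k + 1) ω)
      (φ k ω ⬝ᵥ est k ω))
    (φ k ω) (est k ω) (P k ω) (est (k + 1) ω) (P (k + 1) ω)

/-- `ε` is a martingale difference sequence with respect to `F`. -/
structure IsMartingaleDifference (Pr : Measure Ω) (F : Filtration ℕ mΩ) (ε : ℕ → Ω → ℝ) :
    Prop where
  adapted : ∀ k, Measurable[F k] (ε k)
  integrable : ∀ k, Integrable (ε k) Pr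
  condExp_eq_zero : ∀ k, Pr[ε (k + 1) | F k] =ᵐ[Pr] 0

/-- The conditional absolute moment `E[|ε_{k+1}|^p | F_k]`, as a nonnegative extended random
variable (so that no unconditional integrability is needed). -/
def condMoment (Pr : Measure Ω) (F : Filtration ℕ mΩ) (ε : ℕ → Ω → ℝ) (p : ℝ) (k : ℕ) (ω : Ω) :
    ENNReal :=
  condLExp (F k) Pr (fun ω' => ENNReal.ofReal (|ε (k + 1) ω'| ^ p)) ω

/-- The conditional variance `σ_k² = E[ε_{k+1}² | F_k]` of the noise. -/
def noiseVariance (Pr : Measure Ω) (F : Filtration ℕ mΩ) (ε : ℕ → Ω → ℝ) (k : ℕ) (ω : Ω) : ℝ :=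
  (condLExp (F k) Pr (fun ω' => ENNReal.ofReal (ε (k + 1) ω' ^ 2)) ω).toReal

/-- The averaged weighted prediction error `E_n = (1/n) ∑_{k<n} b_k |y_{k+1} - ŷ_{k+1}|`. -/
def avgPredictionError (b y yHat : ℕ → Ω → ℝ) (n : ℕ) (ω : Ω) : ℝ :=
  (∑ k ∈ Finset.range n, b k ω * |y (k + 1) ω - yHat (k + 1) ω|) / n

end

/-! A clamp is 1-Lipschitz, so the prediction error is at most |x_k| + |ε_{k+1}| with x_k = φ_kᵀ(θ -
θ_k). It suffices that Σ x_k² = O(log n) and that Σ b_k(|ε_{k+1}| - σ_k) is bounded above by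
O(n^{3/4}). Cauchy–Schwarz then bounds Σ|x_k| by O(n^{3/4}) and Σ b_k σ_k by √(n Σ b_k² σ_k²). The
remainder found in this way is O(n^{-1/4}), which the stated rate absorbs.

The logarithmic bound (`exists_sum_sq_le_log`) is a Lyapunov argument with V_k = (θ - ϑ_k)ᵀP_k⁻¹(θ -
ϑ_k). The update adds (β b²/m)φφᵀ to P⁻¹, and the projection does not increase the
P_{k+1}⁻¹-distance to θ. The one-step change of V therefore consists of a drift, a martingale
increment and a term (bv/m)² φᵀP_{k+1}φ. The last telescopes into log det P_n⁻¹, which is O(log n)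
because the regressors are bounded. The martingale sum is at most a small multiple of Σ x_k² plus
O(log n) (`ae_martingale_transform_le`), and the drift absorbs that multiple.

The drift is governed by the conditional mean ψ of the corrected sign innovation
(`signInnovation_eq`), a difference of values of the noise distribution function. The density bounds
make it strongly monotone and Lipschitz in the true output. For the preliminary step the drift is at
most -const·x². For the accelerated step the gain is the difference quotient of ψ towards the
preliminary prediction, so the drift is at most -const·x² plus a multiple of the squared preliminary
error. The theorem is thus applied twice, the first bound feeding the second.

Both probabilistic estimates rest on `ae_sum_le_log_of_exp_moment_le`: products of factors with
conditional mean at most one have mean at most one, and summing them against 1/(n+1)² controls all n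
at once. For the martingale the factors come from Hoeffding's bound, for the nonnegative noise from
(1 + aX)e^{-as}. Adaptedness of the estimates, needed for predictable transforms, requires
measurability of the projection, which is given only by its minimizing property. -/

/-! ### Exponential supermartingales and conditional moments. -/

section Probability

open scoped ENNReal

variable {Ω : Type*} {m : MeasurableSpace Ω} [mΩ : MeasurableSpace Ω]

/-- An inequality between conditional masses on `m`-measurable sets extends to `m`-measurable
weights. -/
theorem lintegral_mul_le_of_setLIntegral_le {Pr : Measure Ω} (hm : m ≤ mΩ)
    {X Y Z : Ω → ℝ≥0∞} (hX : Measurable X) (hY : Measurable Y) (hZ : Measurable[m] Z)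
    (h : ∀ A, MeasurableSet[m] A → ∫⁻ ω in A, X ω ∂Pr ≤ ∫⁻ ω in A, Y ω ∂Pr) :
    ∫⁻ ω, Z ω * X ω ∂Pr ≤ ∫⁻ ω, Z ω * Y ω ∂Pr := by
  have hZ' : Measurable Z := hZ.mono hm le_rfl
  -- The weight sees X and Y only through the measures with these densities, restricted to m; the
  -- hypothesis says exactly that those measures are ordered.
  have key : ∀ T : Ω → ℝ≥0∞, Measurable T →
      ∫⁻ ω, Z ω * T ω ∂Pr = ∫⁻ ω, Z ω ∂((Pr.withDensity T).trim hm) := by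
    intro T hT
    rw [lintegral_trim hm hZ, lintegral_withDensity_eq_lintegral_mul Pr hT hZ']
    exact lintegral_congr fun ω => mul_comm _ _
  rw [key X hX, key Y hY]
  refine lintegral_mono' ?_ le_rfl
  refine Measure.le_iff.2 fun A hA => ?_
  rw [trim_measurableSet_eq hm hA, trim_measurableSet_eq hm hA,
    withDensity_apply _ (hm _ hA), withDensity_apply _ (hm _ hA)]
  exact h A hA

/-- Exponential sums whose conditional exponential moments are at most one grow at most
logarithmically. -/
theorem ae_sum_le_log_of_exp_moment_le {Pr : Measure Ω} [IsProbabilityMeasure Pr]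
    (F : Filtration ℕ mΩ) (x : ℕ → ℕ → Ω → ℝ) (hx : ∀ n k, Measurable[F (k + 1)] (x n k))
    (h : ∀ n k A, MeasurableSet[F k] A →
      ∫⁻ ω in A, ENNReal.ofReal (Real.exp (x n k ω)) ∂Pr ≤ Pr A) :
    ∀ᵐ ω ∂Pr, ∃ K : ℝ, ∀ n : ℕ,
      ∑ k ∈ Finset.range n, x n k ω ≤ 2 * Real.log (n + 1) + K := by
  have hmeas : ∀ n j, j ≤ n → ∀ N, Measurable[F n]
      fun ω => ENNReal.ofReal (Real.exp (∑ k ∈ Finset.range j, x N k ω)) := by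
    intro n j hj N
    have : Measurable[F n] fun ω => ∑ k ∈ Finset.range j, x N k ω := by
      refine Finset.measurable_fun_sum _ fun k hk => ?_
      exact (hx N k).mono (F.mono (by simp at hk; omega)) le_rfl
    exact (Real.measurable_exp.comp this).ennreal_ofReal
  have hprod : ∀ N n, ∫⁻ ω, ENNReal.ofReal (Real.exp (∑ k ∈ Finset.range n, x N k ω)) ∂Pr ≤ 1 := by
    intro N n
    induction n with
    | zero => simp
    | succ n ih =>
      have hstep := lintegral_mul_le_of_setLIntegral_le (Pr := Pr) (F.le n)
        (X := fun ω => ENNReal.ofReal (Real.exp (x N n ω))) (Y := fun _ => 1)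
        (((hx N n).mono (F.le _) le_rfl).exp.ennreal_ofReal)
        measurable_const (hmeas n n le_rfl N) (fun A hA => by simpa using h N n A hA)
      refine le_trans (le_of_eq ?_) (hstep.trans (by simpa using ih))
      refine lintegral_congr fun ω => ?_
      rw [Finset.sum_range_succ, Real.exp_add, ENNReal.ofReal_mul (Real.exp_pos _).le]
  -- The summable weights make Σ Z_n integrable, hence a.s. finite, so every Z_n is below one random
  -- constant. The exponent 2 becomes the factor in 2 log(n+1). Row n may use its own parameter,
  -- since each row is only evaluated at its own horizon.
  set Z : ℕ → Ω → ℝ≥0∞ := fun n ω =>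
    ENNReal.ofReal (1 / ((n : ℝ) + 1) ^ 2) *
      ENNReal.ofReal (Real.exp (∑ k ∈ Finset.range n, x n k ω)) with hZ
  have hZm : ∀ n, Measurable (Z n) := fun n =>
    ((hmeas n n le_rfl n).mono (F.le n) le_rfl).const_mul _
  have hsum : Summable fun n : ℕ => 1 / ((n : ℝ) + 1) ^ 2 := by
    have := (summable_nat_add_iff 1).2 (Real.summable_one_div_nat_pow.2 (one_lt_two))
    simpa using this
  have hfin : ∫⁻ ω, ∑' n, Z n ω ∂Pr ≠ ∞ := by
    rw [lintegral_tsum fun n => (hZm n).aemeasurable]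
    refine ne_top_of_le_ne_top (b := ∑' n : ℕ, ENNReal.ofReal (1 / ((n : ℝ) + 1) ^ 2)) ?_ ?_
    · exact hsum.tsum_ofReal_ne_top
    · refine ENNReal.tsum_le_tsum fun n => ?_
      simp only [hZ]
      rw [lintegral_const_mul _ ((hmeas n n le_rfl n).mono (F.le n) le_rfl)]
      exact mul_le_of_le_one_right' (hprod n n)
  filter_upwards [ae_lt_top (Measurable.tsum hZm) hfin] with ω hω
  set T := (∑' n, Z n ω).toReal
  refine ⟨Real.log (T + 1), fun n => ?_⟩
  have h1 : Z n ω ≤ ∑' n, Z n ω := ENNReal.le_tsum n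
  have h2 : (Z n ω).toReal ≤ T := ENNReal.toReal_mono hω.ne h1
  simp only [hZ, ENNReal.toReal_mul] at h2
  have hn : (0 : ℝ) < (n : ℝ) + 1 := by positivity
  rw [ENNReal.toReal_ofReal (by positivity), ENNReal.toReal_ofReal (by positivity)] at h2
  have h3 : Real.exp (∑ k ∈ Finset.range n, x n k ω) ≤ ((n : ℝ) + 1) ^ 2 * (T + 1) := by
    rw [one_div, inv_mul_le_iff₀ (by positivity)] at h2
    nlinarith [sq_nonneg ((n : ℝ) + 1)]
  have hT : 0 ≤ T := ENNReal.toReal_nonneg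
  have h4 := Real.log_le_log (Real.exp_pos _) h3
  rw [Real.log_exp, Real.log_mul (by positivity) (by positivity), Real.log_pow] at h4
  simpa using h4

/-- The hyperbolic chord bound for the exponential on a symmetric interval. -/
theorem exp_mul_le_cosh_add_sinh {K w : ℝ} (hK : 0 < K) (hw : |w| ≤ K) (a : ℝ) :
    Real.exp (a * w) ≤ Real.cosh (a * K) + w / K * Real.sinh (a * K) := by
  have hw' := abs_le.1 hw
  have h1 : -1 ≤ w / K := by rw [le_div_iff₀ hK]; linarith
  have h2 : w / K ≤ 1 := by rw [div_le_iff₀ hK]; linarith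
  have hc := convexOn_exp.2 (mem_univ (a * K)) (mem_univ (-(a * K)))
    (show 0 ≤ (1 + w / K) / 2 by linarith) (show 0 ≤ (1 - w / K) / 2 by linarith) (by ring)
  simp only [smul_eq_mul] at hc
  have e : (1 + w / K) / 2 * (a * K) + (1 - w / K) / 2 * -(a * K) = a * w := by
    field_simp; ring
  rw [e] at hc
  rw [Real.cosh_eq, Real.sinh_eq]
  linarith

/-- Conditional Hoeffding bound with a predictable factor. -/
theorem setLIntegral_exp_le_of_condExp_eq_zero {Pr : Measure Ω} [IsProbabilityMeasure Pr]
    (hm : m ≤ mΩ) {w ξ : Ω → ℝ} {K : ℝ} (hK : 0 < K) (hw : Measurable w)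
    (hwK : ∀ ω, |w ω| ≤ K) (hw0 : Pr[w | m] =ᵐ[Pr] 0) (hξ : Measurable[m] ξ)
    {A : Set Ω} (hA : MeasurableSet[m] A) :
    ∫⁻ ω in A, ENNReal.ofReal (Real.exp (ξ ω * w ω - K ^ 2 / 2 * ξ ω ^ 2)) ∂Pr ≤ Pr A := by
  -- The slope left after the chord bound and cosh x ≤ exp(x²/2). The Gaussian factor keeps it
  -- bounded by 1/K, so η w is integrable although ξ may be unbounded.
  set η : Ω → ℝ := fun ω => Real.sinh (ξ ω * K) / K * Real.exp (-((ξ ω * K) ^ 2 / 2)) with hη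
  have hηm : Measurable[m] η := by
    have h1 : Measurable[m] fun ω => ξ ω * K := hξ.mul_const K
    exact ((Real.measurable_sinh.comp h1).div_const K).mul
      (Real.measurable_exp.comp ((h1.pow_const 2).div_const 2).neg)
  have hcosh : ∀ x : ℝ, Real.cosh x * Real.exp (-(x ^ 2 / 2)) ≤ 1 := by
    intro x
    rw [Real.exp_neg, ← div_eq_mul_inv, div_le_one (Real.exp_pos _)]
    exact Real.cosh_le_exp_half_sq x
  have hηb : ∀ ω, |η ω| ≤ 1 / K := by
    intro ω
    have : |Real.sinh (ξ ω * K)| ≤ Real.cosh (ξ ω * K) := by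
      rw [Real.sinh_eq, Real.cosh_eq, abs_le]
      constructor <;> linarith [Real.exp_pos (ξ ω * K), Real.exp_pos (-(ξ ω * K))]
    rw [hη]
    simp only [abs_mul, abs_div, Real.abs_exp, abs_of_pos hK]
    calc |Real.sinh (ξ ω * K)| / K * Real.exp (-((ξ ω * K) ^ 2 / 2))
        ≤ Real.cosh (ξ ω * K) / K * Real.exp (-((ξ ω * K) ^ 2 / 2)) := by gcongr
      _ = (Real.cosh (ξ ω * K) * Real.exp (-((ξ ω * K) ^ 2 / 2))) / K := by ring
      _ ≤ 1 / K := by gcongr; exact hcosh _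
  have hpt : ∀ ω, Real.exp (ξ ω * w ω - K ^ 2 / 2 * ξ ω ^ 2) ≤ 1 + η ω * w ω := by
    intro ω
    have h1 := exp_mul_le_cosh_add_sinh hK (hwK ω) (ξ ω)
    have h2 : Real.exp (ξ ω * w ω - K ^ 2 / 2 * ξ ω ^ 2)
        = Real.exp (ξ ω * w ω) * Real.exp (-((ξ ω * K) ^ 2 / 2)) := by
      rw [← Real.exp_add]; congr 1; ring
    rw [h2]
    calc _ ≤ (Real.cosh (ξ ω * K) + w ω / K * Real.sinh (ξ ω * K)) *
          Real.exp (-((ξ ω * K) ^ 2 / 2)) := by gcongr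
      _ = Real.cosh (ξ ω * K) * Real.exp (-((ξ ω * K) ^ 2 / 2)) + η ω * w ω := by
          simp only [hη]; ring
      _ ≤ 1 + η ω * w ω := by gcongr; exact hcosh _
  have hwi : Integrable w Pr :=
    Integrable.of_bound hw.aestronglyMeasurable K (Eventually.of_forall fun ω => by simpa using hwK ω)
  have hηw : Integrable (η * w) Pr := by
    refine Integrable.of_bound ((hηm.mono hm le_rfl).mul hw).aestronglyMeasurable (1 / K * K)
      (Eventually.of_forall fun ω => ?_)
    rw [Pi.mul_apply, norm_mul]
    exact mul_le_mul (hηb ω) (hwK ω) (abs_nonneg _) (by positivity)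
  have hzero : ∫ ω in A, η ω * w ω ∂Pr = 0 := by
    have h1 : ∫ ω in A, (Pr[η * w | m]) ω ∂Pr = ∫ ω in A, (η * w) ω ∂Pr :=
      setIntegral_condExp hm hηw hA
    have h2 : Pr[η * w | m] =ᵐ[Pr] 0 := by
      refine (condExp_mul_of_stronglyMeasurable_left hηm.stronglyMeasurable hηw hwi).trans ?_
      filter_upwards [hw0] with ω h
      simp [h]
    have h3 : ∫ ω in A, (Pr[η * w | m]) ω ∂Pr = 0 := by
      rw [setIntegral_congr_ae (g := fun _ => (0 : ℝ)) (hm _ hA)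
        (by filter_upwards [h2] with ω h _ using h)]
      simp
    exact h1.symm.trans h3
  calc _ ≤ ∫⁻ ω in A, ENNReal.ofReal (1 + η ω * w ω) ∂Pr :=
        lintegral_mono fun ω => ENNReal.ofReal_le_ofReal (hpt ω)
    _ = ENNReal.ofReal (∫ ω in A, (1 + η ω * w ω) ∂Pr) := by
        rw [ofReal_integral_eq_lintegral_ofReal]
        · exact ((integrable_const 1).add hηw).integrableOn
        · exact Eventually.of_forall fun ω => (Real.exp_pos _).le.trans (hpt ω)
    _ = Pr A := by
        have := integral_add (μ := Pr.restrict A) (integrable_const (1 : ℝ)) hηw.integrableOn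
        simp only [Pi.mul_apply] at this
        rw [this, hzero]
        simp

/-- Self-normalized upper bound for martingale transforms of bounded martingale differences: the
transform is dominated by any small multiple of its quadratic variation plus a logarithm. -/
theorem ae_martingale_transform_le {Pr : Measure Ω} [IsProbabilityMeasure Pr]
    (F : Filtration ℕ mΩ) {w ξ : ℕ → Ω → ℝ} {K : ℝ} (hK : 0 < K)
    (hw : ∀ k, Measurable[F (k + 1)] (w k)) (hwK : ∀ k ω, |w k ω| ≤ K)
    (hw0 : ∀ k, Pr[w k | F k] =ᵐ[Pr] 0) (hξ : ∀ k, Measurable[F k] (ξ k)) :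
    ∀ᵐ ω ∂Pr, ∀ τ : ℝ, 0 < τ → ∃ B : ℝ, ∀ n : ℕ,
      ∑ k ∈ Finset.range n, ξ k ω * w k ω ≤
        τ * ∑ k ∈ Finset.range n, ξ k ω ^ 2 + B * (1 + Real.log (n + 1)) := by
  -- Scaling ξ by q = 1/(j+1) leaves the quadratic coefficient K²q/2 after division by q. Countably
  -- many scales give one null set for all τ.
  have hj : ∀ j : ℕ, ∀ᵐ ω ∂Pr, ∃ B : ℝ, ∀ n : ℕ,
      ∑ k ∈ Finset.range n, (1 / ((j : ℝ) + 1) * ξ k ω * w k ω -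
        K ^ 2 / 2 * (1 / ((j : ℝ) + 1) * ξ k ω) ^ 2) ≤ 2 * Real.log (n + 1) + B := by
    intro j
    have hξ' : ∀ k, Measurable[F k] fun ω => 1 / ((j : ℝ) + 1) * ξ k ω := fun k =>
      (hξ k).const_mul _
    refine ae_sum_le_log_of_exp_moment_le F (fun _ k ω => 1 / ((j : ℝ) + 1) * ξ k ω * w k ω -
        K ^ 2 / 2 * (1 / ((j : ℝ) + 1) * ξ k ω) ^ 2) (fun _ k => ?_) fun _ k A hA => ?_
    · have := (hξ' k).mono (F.mono (Nat.le_succ k)) le_rfl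
      exact (this.mul (hw k)).sub ((this.pow_const 2).const_mul _)
    · exact setLIntegral_exp_le_of_condExp_eq_zero (F.le k) hK ((hw k).mono (F.le _) le_rfl)
        (hwK k) (hw0 k) (hξ' k) hA
  filter_upwards [ae_all_iff.2 hj] with ω hω τ hτ
  obtain ⟨j, hj⟩ := exists_nat_one_div_lt (show 0 < τ / (K ^ 2 / 2) by positivity)
  obtain ⟨B, hB⟩ := hω j
  set q : ℝ := 1 / ((j : ℝ) + 1) with hq
  have hqpos : 0 < q := by positivity
  refine ⟨(2 + |B|) / q, fun n => ?_⟩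
  have h1 := hB n
  have h2 : ∑ k ∈ Finset.range n, (q * ξ k ω * w k ω - K ^ 2 / 2 * (q * ξ k ω) ^ 2) =
      q * (∑ k ∈ Finset.range n, ξ k ω * w k ω -
        K ^ 2 / 2 * q * ∑ k ∈ Finset.range n, ξ k ω ^ 2) := by
    rw [Finset.mul_sum, ← Finset.sum_sub_distrib, Finset.mul_sum]
    exact Finset.sum_congr rfl fun k _ => by ring
  rw [h2] at h1
  have hlog : 0 ≤ Real.log ((n : ℝ) + 1) := Real.log_nonneg (by linarith [n.cast_nonneg (α := ℝ)])
  have h3 : ∑ k ∈ Finset.range n, ξ k ω * w k ω -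
        K ^ 2 / 2 * q * ∑ k ∈ Finset.range n, ξ k ω ^ 2 ≤
        (2 + |B|) / q * (1 + Real.log (n + 1)) := by
    rw [div_mul_eq_mul_div (2 + |B|), le_div_iff₀ hqpos, mul_comm _ q]
    refine h1.trans ?_
    nlinarith [le_abs_self B, abs_nonneg B, mul_nonneg (abs_nonneg B) hlog]
  have h4 : K ^ 2 / 2 * q ≤ τ := by
    rw [lt_div_iff₀ (by positivity)] at hj
    linarith
  have h5 : 0 ≤ ∑ k ∈ Finset.range n, ξ k ω ^ 2 := Finset.sum_nonneg fun _ _ => sq_nonneg _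
  nlinarith

/-- Sums of nonnegative variables with bounded conditional expectations grow slower than
`n ^ p` for `p > 1`. -/
theorem ae_sum_le_rpow_of_condLExp_bdd {Pr : Measure Ω} [IsProbabilityMeasure Pr]
    (F : Filtration ℕ mΩ) {X : ℕ → Ω → ℝ} (hX : ∀ k, Measurable (X k)) (hX0 : ∀ k ω, 0 ≤ X k ω)
    (h : ∀ᵐ ω ∂Pr, (⨆ k, condLExp (F k) Pr (fun ω' => ENNReal.ofReal (X k ω')) ω) < ⊤)
    {p : ℝ} (hp : 1 < p) :
    ∀ᵐ ω ∂Pr, ∃ B : ℝ, ∀ n : ℕ, ∑ k ∈ Finset.range n, X k ω ≤ B * ((n : ℝ) + 1) ^ p := by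
  set E : ℕ → Ω → ℝ≥0∞ := fun k => condLExp (F k) Pr (fun ω' => ENNReal.ofReal (X k ω')) with hE
  have hEm : ∀ k, Measurable[F k] (E k) := fun k => measurable_condLExp _ _ _
  have hA : ∀ N k : ℕ, MeasurableSet[F k] {ω | E k ω ≤ N} := fun N k =>
    measurableSet_le (hEm k) measurable_const
  -- Truncation on the F_k-event where the conditional mean is at most N replaces unconditional
  -- integrability; almost every path lies in all these events for some N.
  set Z : ℕ → ℕ → Ω → ℝ≥0∞ := fun N k ω =>
    ENNReal.ofReal (1 / ((k : ℝ) + 1) ^ p) *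
      {ω | E k ω ≤ N}.indicator (fun ω => ENNReal.ofReal (X k ω)) ω with hZ
  have hIm : ∀ N k, Measurable ({ω | E k ω ≤ (N : ℕ)}.indicator
      fun ω => ENNReal.ofReal (X k ω)) := fun N k =>
    (hX k).ennreal_ofReal.indicator (F.le k _ (hA N k))
  have hZm : ∀ N k, Measurable (Z N k) := fun N k => (hIm N k).const_mul _
  have hsum : Summable fun n : ℕ => 1 / ((n : ℝ) + 1) ^ p := by
    have := (summable_nat_add_iff 1).2 (Real.summable_one_div_nat_rpow.2 hp)
    simpa using this
  have hfin : ∀ N, ∫⁻ ω, ∑' k, Z N k ω ∂Pr ≠ ∞ := by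
    intro N
    rw [lintegral_tsum fun k => (hZm N k).aemeasurable]
    refine ne_top_of_le_ne_top
      (b := ∑' k : ℕ, ENNReal.ofReal (1 / ((k : ℝ) + 1) ^ p) * N) ?_ ?_
    · rw [ENNReal.tsum_mul_right]
      exact ENNReal.mul_ne_top hsum.tsum_ofReal_ne_top (ENNReal.natCast_ne_top N)
    · refine ENNReal.tsum_le_tsum fun k => ?_
      simp only [hZ]
      rw [lintegral_const_mul _ (hIm N k)]
      gcongr
      rw [lintegral_indicator (F.le k _ (hA N k)), ← setLIntegral_condLExp (F.le k) Pr _ (hA N k)]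
      calc _ ≤ ∫⁻ ω in {ω | E k ω ≤ N}, (N : ℝ≥0∞) ∂Pr :=
            setLIntegral_mono measurable_const fun ω hω => hω
        _ ≤ N := by
            rw [setLIntegral_const]
            exact mul_le_of_le_one_right' prob_le_one
  filter_upwards [h, ae_all_iff.2 fun N => ae_lt_top (Measurable.tsum (hZm N)) (hfin N)]
    with ω hω hall
  obtain ⟨N, hN⟩ := ENNReal.exists_nat_gt hω.ne
  have hle : ∀ k, E k ω ≤ N := fun k => (le_iSup (fun k => E k ω) k).trans hN.le
  set T := (∑' k, Z N k ω).toReal with hT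
  refine ⟨T, fun n => ?_⟩
  have h1 : ∑ k ∈ Finset.range n, 1 / ((k : ℝ) + 1) ^ p * X k ω ≤ T := by
    have h2 : ∑ k ∈ Finset.range n, Z N k ω ≤ ∑' k, Z N k ω := ENNReal.sum_le_tsum _
    have h3 := ENNReal.toReal_mono (hall N).ne h2
    rw [ENNReal.toReal_sum fun k _ => (ENNReal.ne_top_of_tsum_ne_top (hall N).ne k)] at h3
    refine le_trans (le_of_eq (Finset.sum_congr rfl fun k _ => ?_)) h3
    simp only [hZ]
    rw [indicator_of_mem (show ω ∈ {ω | E k ω ≤ N} from hle k), ENNReal.toReal_mul,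
      ENNReal.toReal_ofReal (by positivity), ENNReal.toReal_ofReal (hX0 k ω)]
  have hn : (0 : ℝ) ≤ (n : ℝ) + 1 := by positivity
  calc ∑ k ∈ Finset.range n, X k ω
      ≤ ∑ k ∈ Finset.range n, ((n : ℝ) + 1) ^ p * (1 / ((k : ℝ) + 1) ^ p * X k ω) := by
        refine Finset.sum_le_sum fun k hk => ?_
        have hk' : (k : ℝ) + 1 ≤ (n : ℝ) + 1 := by
          have := Finset.mem_range.1 hk
          have : (k : ℝ) ≤ n := by exact_mod_cast this.le
          linarith
        have hpos : (0 : ℝ) < ((k : ℝ) + 1) ^ p := by positivity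
        rw [← mul_assoc, mul_one_div]
        refine le_mul_of_one_le_left (hX0 k ω) ?_
        rw [one_le_div hpos]
        exact Real.rpow_le_rpow (by positivity) hk' (by linarith)
    _ = ((n : ℝ) + 1) ^ p * ∑ k ∈ Finset.range n, 1 / ((k : ℝ) + 1) ^ p * X k ω := by
        rw [Finset.mul_sum]
    _ ≤ T * ((n : ℝ) + 1) ^ p := by
        rw [mul_comm]; gcongr

/-- Sums of nonnegative variables exceed the sums of their conditional means by at most
`O(n ^ (3 / 4))`, if the sums of squares are `O(n ^ (5 / 4))`. -/
theorem ae_sum_sub_condMean_le {Pr : Measure Ω} [IsProbabilityMeasure Pr]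
    (F : Filtration ℕ mΩ) {X s : ℕ → Ω → ℝ} (hX : ∀ k, Measurable[F (k + 1)] (X k))
    (hX0 : ∀ k ω, 0 ≤ X k ω) (hs : ∀ k, Measurable[F k] (s k)) (hs0 : ∀ k ω, 0 ≤ s k ω)
    (hE : ∀ k, condLExp (F k) Pr (fun ω => ENNReal.ofReal (X k ω)) ≤ᵐ[Pr]
      fun ω => ENNReal.ofReal (s k ω))
    (hX2 : ∀ᵐ ω ∂Pr, ∃ B : ℝ, ∀ n : ℕ,
      ∑ k ∈ Finset.range n, X k ω ^ 2 ≤ B * ((n : ℝ) + 1) ^ (5 / 4 : ℝ)) :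
    ∀ᵐ ω ∂Pr, ∃ B : ℝ, ∀ n : ℕ,
      ∑ k ∈ Finset.range n, (X k ω - s k ω) ≤ B * ((n : ℝ) + 1) ^ (3 / 4 : ℝ) := by
  have hXm : ∀ k, Measurable (X k) := fun k => (hX k).mono (F.le _) le_rfl
  have hsm : ∀ k, Measurable (s k) := fun k => (hs k).mono (F.le _) le_rfl
  -- With N = n + 1, this scale turns the quadratic error a²·N^{5/4} into N^{1/4}; dividing by a
  -- gives N^{3/4}. Using log(1 + aX) instead of aX avoids any exponential moment of X.
  set a : ℕ → ℝ := fun n => ((n : ℝ) + 1) ^ (-(1 / 2) : ℝ) with ha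
  have ha0 : ∀ n, 0 < a n := fun n => by positivity
  have key := ae_sum_le_log_of_exp_moment_le (Pr := Pr) F
    (fun n k ω => Real.log (1 + a n * X k ω) - a n * s k ω) (fun n k => ?_) fun n k A hA => ?_
  · filter_upwards [key, hX2] with ω ⟨B, hB⟩ ⟨B2, hB2⟩
    -- The 8 is 2·4: the factor 2 of the logarithmic bound times the 4 in log N ≤ 4 N^{1/4}.
    refine ⟨8 + |B| + B2 / 2, fun n => ?_⟩
    have h1 : ∀ k, a n * (X k ω - s k ω) - a n ^ 2 / 2 * X k ω ^ 2 ≤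
        Real.log (1 + a n * X k ω) - a n * s k ω := by
      intro k
      have hx : 0 ≤ a n * X k ω := mul_nonneg (ha0 n).le (hX0 k ω)
      have h2 := Real.le_log_one_add_of_nonneg hx
      have h3 : a n * X k ω - (a n * X k ω) ^ 2 / 2 ≤ 2 * (a n * X k ω) / (a n * X k ω + 2) := by
        rw [le_div_iff₀ (by positivity)]
        nlinarith [pow_nonneg hx 3]
      nlinarith
    have h2 := (Finset.sum_le_sum fun k (_ : k ∈ Finset.range n) => h1 k).trans (hB n)
    rw [Finset.sum_sub_distrib, ← Finset.mul_sum, ← Finset.mul_sum] at h2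
    set N : ℝ := (n : ℝ) + 1 with hN
    have hN1 : 1 ≤ N := by simp [hN]
    have hN0 : 0 < N := by linarith
    have hl : Real.log N ≤ 4 * N ^ (1 / 4 : ℝ) := by
      have := Real.log_le_rpow_div hN0.le (show (0 : ℝ) < 1 / 4 by norm_num)
      linarith
    have hN4 : 1 ≤ N ^ (1 / 4 : ℝ) := Real.one_le_rpow hN1 (by norm_num)
    have e1 : a n * N ^ (3 / 4 : ℝ) = N ^ (1 / 4 : ℝ) := by
      rw [ha]; simp only; rw [← Real.rpow_add hN0]; norm_num
    have e2 : a n ^ 2 * N ^ (5 / 4 : ℝ) = N ^ (1 / 4 : ℝ) := by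
      rw [ha]; simp only; rw [← Real.rpow_mul_natCast hN0.le, ← Real.rpow_add hN0]; norm_num
    refine le_of_mul_le_mul_left ?_ (ha0 n)
    have h3 : a n ^ 2 / 2 * ∑ k ∈ Finset.range n, X k ω ^ 2 ≤ B2 / 2 * N ^ (1 / 4 : ℝ) := by
      rw [← e2]
      nlinarith [mul_le_mul_of_nonneg_left (hB2 n) (sq_nonneg (a n))]
    have h4 : a n * ((8 + |B| + B2 / 2) * N ^ (3 / 4 : ℝ)) =
        (8 + |B| + B2 / 2) * N ^ (1 / 4 : ℝ) := by rw [← e1]; ring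
    rw [h4]
    nlinarith [le_abs_self B, abs_nonneg B]
  · have h1 := ((hX k).const_mul (a n)).const_add 1
    exact (Real.measurable_log.comp h1).sub
      (((hs k).mono (F.mono (Nat.le_succ k)) le_rfl).const_mul _)
  · have hZm : Measurable[F k] (A.indicator fun ω => ENNReal.ofReal (Real.exp (-(a n * s k ω)))) :=
      (Real.measurable_exp.comp ((hs k).const_mul _).neg).ennreal_ofReal.indicator hA
    have h1 := lintegral_mul_le_of_setLIntegral_le (Pr := Pr) (F.le k)
      (X := fun ω => 1 + ENNReal.ofReal (a n) * ENNReal.ofReal (X k ω))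
      (Y := fun ω => 1 + ENNReal.ofReal (a n) * ENNReal.ofReal (s k ω))
      (((hXm k).ennreal_ofReal.const_mul _).const_add _)
      (((hsm k).ennreal_ofReal.const_mul _).const_add _) hZm ?_
    · calc _ = ∫⁻ ω, A.indicator (fun ω => ENNReal.ofReal (Real.exp (-(a n * s k ω)))) ω *
            (1 + ENNReal.ofReal (a n) * ENNReal.ofReal (X k ω)) ∂Pr := by
            rw [← lintegral_indicator (F.le k _ hA)]
            refine lintegral_congr fun ω => ?_
            by_cases hω : ω ∈ A
            · simp only [indicator_of_mem hω]
              have hx : 0 ≤ a n * X k ω := mul_nonneg (ha0 n).le (hX0 k ω)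
              rw [sub_eq_neg_add, Real.exp_add, Real.exp_log (by positivity),
                ENNReal.ofReal_mul (Real.exp_pos _).le, ENNReal.ofReal_add zero_le_one hx,
                ENNReal.ofReal_mul (ha0 n).le, ENNReal.ofReal_one]
            · simp [hω]
        _ ≤ _ := h1
        _ ≤ ∫⁻ ω, A.indicator 1 ω ∂Pr := by
            refine lintegral_mono fun ω => ?_
            by_cases hω : ω ∈ A
            · simp only [indicator_of_mem hω, Pi.one_apply]
              have hx : 0 ≤ a n * s k ω := mul_nonneg (ha0 n).le (hs0 k ω)
              rw [← ENNReal.ofReal_mul (ha0 n).le, ← ENNReal.ofReal_one,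
                ← ENNReal.ofReal_add zero_le_one hx, ← ENNReal.ofReal_mul (Real.exp_pos _).le]
              refine ENNReal.ofReal_le_ofReal ?_
              rw [Real.exp_neg, inv_mul_le_iff₀ (Real.exp_pos _)]
              linarith [Real.add_one_le_exp (a n * s k ω)]
            · simp [hω]
        _ = Pr A := lintegral_indicator_one (F.le k _ hA)
    · intro B hB
      rw [lintegral_add_left measurable_const, lintegral_add_left measurable_const,
        lintegral_const_mul _ (hXm k).ennreal_ofReal, lintegral_const_mul _ (hsm k).ennreal_ofReal]
      refine add_le_add le_rfl (mul_le_mul' le_rfl ?_)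
      rw [← setLIntegral_condLExp (F.le k) Pr (fun ω => ENNReal.ofReal (X k ω)) hB]
      exact lintegral_mono_ae (ae_restrict_of_ae (hE k))

/-- The conditional absolute first moment is at most the square root of the conditional second
moment. -/
theorem condLExp_ofReal_abs_le_sqrt {Pr : Measure Ω} [IsProbabilityMeasure Pr] (hm : m ≤ mΩ)
    {X : Ω → ℝ} (hX : Measurable X)
    (hfin : ∀ᵐ ω ∂Pr, condLExp m Pr (fun ω => ENNReal.ofReal (X ω ^ 2)) ω < ∞) :
    condLExp m Pr (fun ω => ENNReal.ofReal |X ω|) ≤ᵐ[Pr] fun ω =>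
      ENNReal.ofReal (Real.sqrt (condLExp m Pr (fun ω => ENNReal.ofReal (X ω ^ 2)) ω).toReal) := by
  -- This is |X| ≤ X²/(2j) + j/2. Rational j keep the exceptional sets countable, so j may later be
  -- chosen depending on ω, just above the optimal √v.
  have hq : ∀ j : ℚ, 0 < j → ∀ᵐ ω ∂Pr, condLExp m Pr (fun ω => ENNReal.ofReal |X ω|) ω ≤
      ENNReal.ofReal (1 / (2 * j)) * condLExp m Pr (fun ω => ENNReal.ofReal (X ω ^ 2)) ω +
        ENNReal.ofReal (j / 2) := by
    intro j hj
    have hj' : (0 : ℝ) < j := by exact_mod_cast hj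
    have hX2 : Measurable fun ω => ENNReal.ofReal (X ω ^ 2) := (hX.pow_const 2).ennreal_ofReal
    have h1 : condLExp m Pr (fun ω => ENNReal.ofReal |X ω|) ≤ᵐ[Pr] condLExp m Pr
        (ENNReal.ofReal (1 / (2 * j)) • (fun ω => ENNReal.ofReal (X ω ^ 2)) +
          fun _ => ENNReal.ofReal (j / 2)) := by
      refine condLExp_mono (Eventually.of_forall fun ω => ?_)
      simp only [Pi.add_apply, Pi.smul_apply, smul_eq_mul]
      rw [← ENNReal.ofReal_mul (by positivity), ← ENNReal.ofReal_add (by positivity) (by positivity)]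
      refine ENNReal.ofReal_le_ofReal ?_
      have : 1 / (2 * (j : ℝ)) * X ω ^ 2 + j / 2 = (|X ω| ^ 2 + j ^ 2) / (2 * j) := by
        rw [sq_abs]; field_simp
      rw [this, le_div_iff₀ (by positivity)]
      nlinarith [sq_nonneg (|X ω| - j)]
    have h2 := condLExp_add_left (P := Pr) (mΩ := m)
      (X := ENNReal.ofReal (1 / (2 * j)) • (fun ω => ENNReal.ofReal (X ω ^ 2)))
      (fun _ => ENNReal.ofReal (j / 2)) ((hX2.const_mul _).aemeasurable)
    have h3 := condLExp_smul (P := Pr) (mΩ := m) (fun ω => ENNReal.ofReal (X ω ^ 2))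
      hX2.aemeasurable (ENNReal.ofReal (1 / (2 * j)))
    filter_upwards [h1, h2, h3] with ω g1 g2 g3
    rw [g2, Pi.add_apply, g3, condLExp_const hm] at g1
    exact g1
  filter_upwards [hfin, ae_all_iff.2 fun j : {j : ℚ // 0 < j} => hq j j.2] with ω hω hall
  set v := (condLExp m Pr (fun ω => ENNReal.ofReal (X ω ^ 2)) ω).toReal with hv
  have hv0 : 0 ≤ v := ENNReal.toReal_nonneg
  have hve : condLExp m Pr (fun ω => ENNReal.ofReal (X ω ^ 2)) ω = ENNReal.ofReal v :=
    (ENNReal.ofReal_toReal hω.ne).symm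
  have hb : ∀ j : ℚ, 0 < j → condLExp m Pr (fun ω => ENNReal.ofReal |X ω|) ω ≤
      ENNReal.ofReal (1 / (2 * j) * v + j / 2) := by
    intro j hj
    have hj' : (0 : ℝ) < j := by exact_mod_cast hj
    have := hall ⟨j, hj⟩
    rwa [hve, ← ENNReal.ofReal_mul (by positivity),
      ← ENNReal.ofReal_add (by positivity) (by positivity)] at this
  refine ENNReal.le_of_forall_pos_le_add fun δ hδ _ => ?_
  have hδ' : (0 : ℝ) < δ := hδ
  obtain ⟨j, hj1, hj2⟩ := exists_rat_btwn (show Real.sqrt v < Real.sqrt v + δ by linarith)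
  have hj' : (0 : ℝ) < j := (Real.sqrt_nonneg v).trans_lt hj1
  refine (hb j (by exact_mod_cast hj')).trans ?_
  rw [← ENNReal.ofReal_coe_nnreal, ← ENNReal.ofReal_add (Real.sqrt_nonneg _) hδ'.le]
  refine ENNReal.ofReal_le_ofReal ?_
  have h1 : 1 / (2 * (j : ℝ)) * v ≤ j / 2 := by
    rw [one_div, inv_mul_le_iff₀ (by positivity)]
    nlinarith [Real.sq_sqrt hv0, Real.sqrt_nonneg v]
  linarith

end Probability

/-! ### Distribution functions of integrable densities. -/

section Density

variable {g : ℝ → ℝ}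

theorem cdfOf_sub (hi : Integrable g) (a b : ℝ) : cdfOf g b - cdfOf g a = ∫ t in a..b, g t :=
  intervalIntegral.integral_Iic_sub_Iic hi.integrableOn hi.integrableOn

theorem continuous_cdfOf (hi : Integrable g) : Continuous (cdfOf g) := by
  have h := hi.continuous_primitive 0
  have e : cdfOf g = fun x => cdfOf g 0 + ∫ t in (0 : ℝ)..x, g t := by
    ext x; rw [← cdfOf_sub hi]; ring
  rw [e]
  exact continuous_const.add h

theorem monotone_cdfOf (hi : Integrable g) (h0 : ∀ x, 0 ≤ g x) : Monotone (cdfOf g) := by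
  intro a b hab
  have := intervalIntegral.integral_nonneg_of_forall (μ := volume) hab h0
  rw [← cdfOf_sub hi] at this
  linarith

theorem cdfOf_nonneg (h0 : ∀ x, 0 ≤ g x) (x : ℝ) : 0 ≤ cdfOf g x :=
  setIntegral_nonneg measurableSet_Iic fun t _ => h0 t

theorem cdfOf_le_one (hi : Integrable g) (h0 : ∀ x, 0 ≤ g x) (h1 : ∫ x, g x = 1) (x : ℝ) :
    cdfOf g x ≤ 1 := by
  rw [← h1]
  exact setIntegral_le_integral hi (Eventually.of_forall h0)

theorem mul_sub_le_cdfOf_sub (hi : Integrable g) {a b h : ℝ} (hab : a ≤ b)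
    (hg : ∀ x ∈ Icc a b, h ≤ g x) : h * (b - a) ≤ cdfOf g b - cdfOf g a := by
  rw [cdfOf_sub hi]
  have := intervalIntegral.integral_mono_on (μ := volume) hab
    (intervalIntegrable_const (c := h)) hi.intervalIntegrable hg
  simpa [mul_comm] using this

theorem cdfOf_sub_le_mul_sub (hi : Integrable g) {a b H : ℝ} (hab : a ≤ b)
    (hg : ∀ x ∈ Icc a b, g x ≤ H) : cdfOf g b - cdfOf g a ≤ H * (b - a) := by
  rw [cdfOf_sub hi]
  have := intervalIntegral.integral_mono_on (μ := volume) hab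
    hi.intervalIntegrable (intervalIntegrable_const (c := H)) hg
  simpa [mul_comm] using this

theorem abs_cdfOf_sub_le (hi : Integrable g) (h0 : ∀ x, 0 ≤ g x) {a b H : ℝ}
    (hg : ∀ x ∈ uIcc a b, g x ≤ H) : |cdfOf g b - cdfOf g a| ≤ H * |b - a| := by
  rcases le_total a b with hab | hab
  · rw [abs_of_nonneg (sub_nonneg.2 (monotone_cdfOf hi h0 hab)), abs_of_nonneg (sub_nonneg.2 hab)]
    exact cdfOf_sub_le_mul_sub hi hab fun x hx => hg x (by rwa [uIcc_of_le hab])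
  · rw [abs_sub_comm, abs_sub_comm b a,
      abs_of_nonneg (sub_nonneg.2 (monotone_cdfOf hi h0 hab)), abs_of_nonneg (sub_nonneg.2 hab)]
    exact cdfOf_sub_le_mul_sub hi hab fun x hx => hg x (by rwa [uIcc_of_ge hab])

end Density

/-! ### The conditional distribution function at random points. -/

section ConditionalLaw

open scoped Topology

variable {Ω : Type*} {m : MeasurableSpace Ω} [mΩ : MeasurableSpace Ω] {Pr : Measure Ω}
  {X : Ω → ℝ} {g : Ω → ℝ → ℝ}

/-- A Carathéodory function, continuous in one variable and measurable in the other, is jointly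
measurable. This permits evaluation at m-measurable random points. -/
theorem IsMedianZeroCondDensity.measurable_uncurry (hg : IsMedianZeroCondDensity Pr m X g) :
    @Measurable (ℝ × Ω) ℝ (@Prod.instMeasurableSpace ℝ Ω _ m) _ fun p => g p.2 p.1 :=
  @measurable_uncurry_of_continuous_of_measurable Ω ℝ ℝ _ _ _ _ _ _ _ _ _ m
    (fun x ω => g ω x) hg.continuous hg.measurable

theorem IsMedianZeroCondDensity.measurable_eval (hg : IsMedianZeroCondDensity Pr m X g)
    {x : Ω → ℝ} (hx : Measurable[m] x) : Measurable[m] fun ω => g ω (x ω) :=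
  hg.measurable_uncurry.comp (hx.prodMk (@measurable_id Ω m))

theorem IsMedianZeroCondDensity.measurable_cdfOf (hg : IsMedianZeroCondDensity Pr m X g)
    {x : Ω → ℝ} (hx : Measurable[m] x) : Measurable[m] fun ω => cdfOf (g ω) (x ω) := by
  have h1 : ∀ c : ℝ, Measurable[m] fun ω => cdfOf (g ω) c := by
    intro c
    have hsm : @StronglyMeasurable (Ω × ℝ) ℝ _ (@Prod.instMeasurableSpace Ω ℝ m _)
        fun p => g p.1 p.2 :=
      (hg.measurable_uncurry.comp (@measurable_swap Ω ℝ m _)).stronglyMeasurable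
    exact (@MeasureTheory.StronglyMeasurable.integral_prod_right' Ω ℝ ℝ m _
      (volume.restrict (Iic c)) _ _ _ _ hsm).measurable
  have h2 := @measurable_uncurry_of_continuous_of_measurable Ω ℝ ℝ _ _ _ _ _ _ _ _ _ m
    (fun x ω => cdfOf (g ω) x) (fun ω => continuous_cdfOf (hg.integrable ω)) h1
  exact h2.comp (hx.prodMk (@measurable_id Ω m))

theorem IsMedianZeroCondDensity.abs_cdfOf_le (hg : IsMedianZeroCondDensity Pr m X g) (ω : Ω)
    (x : ℝ) : |cdfOf (g ω) x| ≤ 1 :=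
  abs_le.2 ⟨by linarith [cdfOf_nonneg (hg.nonneg ω) x],
    cdfOf_le_one (hg.integrable ω) (hg.nonneg ω) (hg.integral_eq_one ω) x⟩

variable [IsProbabilityMeasure Pr]

/-- The conditional distribution function evaluated at a known random point with countable
range. -/
theorem IsMedianZeroCondDensity.condExp_indicator_le_of_countable
    (hg : IsMedianZeroCondDensity Pr m X g) (hX : Measurable X)
    {y : Ω → ℝ} (hy : Measurable[m] y) (hc : (range y).Countable) (hm : m ≤ mΩ) :
    Pr[{ω | X ω ≤ y ω}.indicator (fun _ => (1 : ℝ)) | m] =ᵐ[Pr] fun ω => cdfOf (g ω) (y ω) := by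
  have hset : ∀ z : Ω → ℝ, Measurable[m] z → MeasurableSet {ω | X ω ≤ z ω} := fun z hz =>
    measurableSet_le hX (hz.mono hm le_rfl)
  have hint : ∀ z : Ω → ℝ, Measurable[m] z →
      Integrable ({ω | X ω ≤ z ω}.indicator (fun _ => (1 : ℝ))) Pr := fun z hz =>
    (integrable_const 1).indicator (hset z hz)
  -- On the m-event where y = c the random threshold may be replaced by the constant c; only
  -- countably many such events occur.
  have key : ∀ c ∈ range y, ∀ᵐ ω ∂Pr, y ω = c →
      (Pr[{ω | X ω ≤ y ω}.indicator (fun _ => (1 : ℝ)) | m]) ω = cdfOf (g ω) c := by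
    intro c _
    have hA : MeasurableSet[m] (y ⁻¹' {c}) := hy (measurableSet_singleton c)
    have h1 := condExp_indicator (μ := Pr) (m := m) (hint y hy) hA
    have h2 := condExp_indicator (μ := Pr) (m := m) (hint (fun _ => c) measurable_const) hA
    have h3 : (y ⁻¹' {c}).indicator ({ω | X ω ≤ y ω}.indicator fun _ => (1 : ℝ)) =
        (y ⁻¹' {c}).indicator ({ω | X ω ≤ c}.indicator fun _ => (1 : ℝ)) := by
      ext ω
      by_cases hω : y ω = c
      · simp [indicator, hω]
      · simp [indicator, hω]
    rw [h3] at h1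
    filter_upwards [h1, h2, hg.cond_cdf c] with ω g1 g2 g3 hω
    rw [g1] at g2
    rw [indicator_of_mem (show ω ∈ y ⁻¹' {c} from hω),
      indicator_of_mem (show ω ∈ y ⁻¹' {c} from hω), g3] at g2
    exact g2
  filter_upwards [(ae_ball_iff hc).2 key] with ω hω
  exact hω _ ⟨ω, rfl⟩ rfl

/-- Passage to the limit along known approximations of the evaluation point. -/
theorem IsMedianZeroCondDensity.condExp_indicator_of_tendsto
    (hg : IsMedianZeroCondDensity Pr m X g) (hX : Measurable X)
    {x : Ω → ℝ} (hx : Measurable[m] x) {S : Set Ω} {y : ℕ → Ω → ℝ} (hy : ∀ n, Measurable[m] (y n))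
    (hc : ∀ n, (range (y n)).Countable) (hm : m ≤ mΩ)
    (hlim : ∀ ω, Tendsto (fun n => y n ω) atTop (𝓝 (x ω)))
    (hS : ∀ ω, ∀ᶠ n in atTop, X ω ≤ y n ω ↔ ω ∈ S) :
    Pr[S.indicator (fun _ => (1 : ℝ)) | m] =ᵐ[Pr] fun ω => cdfOf (g ω) (x ω) := by
  have hF : ∀ z : Ω → ℝ, Measurable[m] z → Integrable (fun ω => cdfOf (g ω) (z ω)) Pr :=
    fun z hz => Integrable.of_bound
      ((hg.measurable_cdfOf hz).mono hm le_rfl).aestronglyMeasurable 1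
      (Eventually.of_forall fun ω => hg.abs_cdfOf_le ω _)
  -- The two approximating sequences are bounded by 1 and have equal conditional expectations for
  -- each n, so dominated convergence passes the equality to the limits.
  have h := tendsto_condExp_unique (μ := Pr) (m := m)
    (fun n => {ω | X ω ≤ y n ω}.indicator fun _ => (1 : ℝ))
    (fun n ω => cdfOf (g ω) (y n ω)) (S.indicator fun _ => (1 : ℝ))
    (fun ω => cdfOf (g ω) (x ω))
    (fun n => (integrable_const 1).indicator (measurableSet_le hX ((hy n).mono hm le_rfl)))
    (fun n => hF _ (hy n)) (Eventually.of_forall fun ω => ?_)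
    (Eventually.of_forall fun ω =>
      ((continuous_cdfOf (hg.integrable ω)).tendsto _).comp (hlim ω))
    (fun _ => 1) (integrable_const _) (fun _ => 1) (integrable_const _)
    (fun n => Eventually.of_forall fun ω => ?_)
    (fun n => Eventually.of_forall fun ω => hg.abs_cdfOf_le ω _) fun n => ?_
  · refine h.trans ?_
    rw [condExp_of_stronglyMeasurable hm (hg.measurable_cdfOf hx).stronglyMeasurable (hF x hx)]
  · refine tendsto_const_nhds.congr' ?_
    filter_upwards [hS ω] with n hn
    by_cases hω : ω ∈ S
    · rw [indicator_of_mem hω, indicator_of_mem (show ω ∈ {ω | X ω ≤ y n ω} from hn.2 hω)]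
    · rw [indicator_of_notMem hω, indicator_of_notMem (show ω ∉ {ω | X ω ≤ y n ω} from fun h => hω (hn.1 h))]
  · by_cases hω : X ω ≤ y n ω <;> simp [indicator, hω]
  · refine (hg.condExp_indicator_le_of_countable hX (hy n) (hc n) hm).trans ?_
    rw [condExp_of_stronglyMeasurable hm (hg.measurable_cdfOf (hy n)).stronglyMeasurable
      (hF _ (hy n))]

/-- Approximation by grid points strictly above x and at distance at most 1/(n+1): the event X ≤ y_n
eventually agrees with X ≤ x. -/
theorem IsMedianZeroCondDensity.condExp_indicator_le
    (hg : IsMedianZeroCondDensity Pr m X g) (hX : Measurable X)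
    {x : Ω → ℝ} (hx : Measurable[m] x) (hm : m ≤ mΩ) :
    Pr[{ω | X ω ≤ x ω}.indicator (fun _ => (1 : ℝ)) | m] =ᵐ[Pr] fun ω => cdfOf (g ω) (x ω) := by
  have hlt : ∀ (n : ℕ) ω, x ω < (⌊((n : ℝ) + 1) * x ω⌋ + 1 : ℝ) / (n + 1) := by
    intro n ω
    rw [lt_div_iff₀ (by positivity), mul_comm]
    exact Int.lt_floor_add_one _
  have hle : ∀ (n : ℕ) ω, (⌊((n : ℝ) + 1) * x ω⌋ + 1 : ℝ) / (n + 1) ≤ x ω + 1 / ((n : ℝ) + 1) := by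
    intro n ω
    rw [div_le_iff₀ (by positivity), add_mul (x ω), one_div_mul_cancel (by positivity), mul_comm (x ω)]
    linarith [Int.floor_le (((n : ℝ) + 1) * x ω)]
  have hlim : ∀ ω, Tendsto (fun n : ℕ => (⌊((n : ℝ) + 1) * x ω⌋ + 1 : ℝ) / (n + 1)) atTop
      (𝓝 (x ω)) := fun ω =>
    tendsto_of_tendsto_of_tendsto_of_le_of_le tendsto_const_nhds
      (by simpa using tendsto_const_nhds.add (tendsto_one_div_add_atTop_nhds_zero_nat (𝕜 := ℝ)))
      (fun n => (hlt n ω).le) fun n => hle n ω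
  refine hg.condExp_indicator_of_tendsto hX hx
    (y := fun n ω => (⌊((n : ℝ) + 1) * x ω⌋ + 1 : ℝ) / (n + 1)) (fun n => ?_) (fun n => ?_) hm
    hlim fun ω => ?_
  · have : Measurable[m] fun ω => ⌊((n : ℝ) + 1) * x ω⌋ :=
      @Measurable.comp Ω ℝ ℤ m _ _ _ _ Int.measurable_floor (hx.const_mul _)
    have h2 : Measurable[m] fun ω => ((⌊((n : ℝ) + 1) * x ω⌋ : ℤ) : ℝ) :=
      @Measurable.comp Ω ℤ ℝ m _ _ _ _ measurable_from_top this
    exact (h2.add_const 1).div_const _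
  · refine (countable_range fun j : ℤ => ((j : ℝ) + 1) / (n + 1)).mono ?_
    rintro _ ⟨ω, rfl⟩
    exact ⟨⌊((n : ℝ) + 1) * x ω⌋, rfl⟩
  · rcases le_or_gt (X ω) (x ω) with h | h
    · exact Eventually.of_forall fun n => ⟨fun _ => h, fun _ => h.trans (hlt n ω).le⟩
    · filter_upwards [(hlim ω).eventually_lt_const h] with n hn
      exact ⟨fun h' => absurd (h'.trans_lt hn) (lt_irrefl _), fun h' => h'.trans (hlt n ω).le⟩

/-- Here the grid points lie strictly below x, so X ≤ y_n eventually agrees with X < x. Continuity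
of the distribution function makes the limit the same as for the weak inequality. -/
theorem IsMedianZeroCondDensity.condExp_indicator_lt
    (hg : IsMedianZeroCondDensity Pr m X g) (hX : Measurable X)
    {x : Ω → ℝ} (hx : Measurable[m] x) (hm : m ≤ mΩ) :
    Pr[{ω | X ω < x ω}.indicator (fun _ => (1 : ℝ)) | m] =ᵐ[Pr] fun ω => cdfOf (g ω) (x ω) := by
  have hlt : ∀ (n : ℕ) ω, (⌈((n : ℝ) + 1) * x ω⌉ - 1 : ℝ) / (n + 1) < x ω := by
    intro n ω
    rw [div_lt_iff₀ (by positivity), mul_comm (x ω)]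
    linarith [Int.ceil_lt_add_one (((n : ℝ) + 1) * x ω)]
  have hle : ∀ (n : ℕ) ω, x ω - 1 / ((n : ℝ) + 1) ≤ (⌈((n : ℝ) + 1) * x ω⌉ - 1 : ℝ) / (n + 1) := by
    intro n ω
    rw [le_div_iff₀ (by positivity), sub_mul (x ω), one_div_mul_cancel (by positivity), mul_comm (x ω)]
    linarith [Int.le_ceil (((n : ℝ) + 1) * x ω)]
  have hlim : ∀ ω, Tendsto (fun n : ℕ => (⌈((n : ℝ) + 1) * x ω⌉ - 1 : ℝ) / (n + 1)) atTop
      (𝓝 (x ω)) := fun ω =>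
    tendsto_of_tendsto_of_tendsto_of_le_of_le
      (by simpa using tendsto_const_nhds.sub (tendsto_one_div_add_atTop_nhds_zero_nat (𝕜 := ℝ)))
      tendsto_const_nhds (fun n => hle n ω) fun n => (hlt n ω).le
  refine hg.condExp_indicator_of_tendsto hX hx
    (y := fun n ω => (⌈((n : ℝ) + 1) * x ω⌉ - 1 : ℝ) / (n + 1)) (fun n => ?_) (fun n => ?_) hm
    hlim fun ω => ?_
  · have : Measurable[m] fun ω => ⌈((n : ℝ) + 1) * x ω⌉ :=
      @Measurable.comp Ω ℝ ℤ m _ _ _ _ Int.measurable_ceil (hx.const_mul _)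
    have h2 : Measurable[m] fun ω => ((⌈((n : ℝ) + 1) * x ω⌉ : ℤ) : ℝ) :=
      @Measurable.comp Ω ℤ ℝ m _ _ _ _ measurable_from_top this
    exact (h2.sub_const 1).div_const _
  · refine (countable_range fun j : ℤ => ((j : ℝ) - 1) / (n + 1)).mono ?_
    rintro _ ⟨ω, rfl⟩
    exact ⟨⌈((n : ℝ) + 1) * x ω⌉, rfl⟩
  · rcases lt_or_ge (X ω) (x ω) with h | h
    · filter_upwards [(hlim ω).eventually_const_lt h] with n hn
      exact ⟨fun _ => h, fun _ => hn.le⟩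
    · exact Eventually.of_forall fun n => ⟨fun h' => h'.trans_lt (hlt n ω),
        fun h' => absurd (h.trans_lt h') (lt_irrefl _)⟩

end ConditionalLaw

/-! ### Mean and martingale parts of the sign innovation. -/

noncomputable section

/-- The conditional mean of the corrected sign innovation, when the saturation is a clamp to
`[l, u]`, the current prediction is `s` and the noiseless output is `t`. -/
def innovationMean (g : ℝ → ℝ) (l u s t : ℝ) : ℝ :=
  if s ≤ l then cdfOf g (l - s) - cdfOf g (l - t)
  else if u ≤ s then cdfOf g (u - s) - cdfOf g (u - t)
  else 1 - 2 * cdfOf g (s - t)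

/-- The martingale difference part of the corrected sign innovation, as a function of the
noise `e`. -/
def innovationNoise (g : ℝ → ℝ) (l u s t e : ℝ) : ℝ :=
  (if s < u then cdfOf g (max l (min s u) - t) - (if e ≤ max l (min s u) - t then 1 else 0) else 0)
    + (if l < s then cdfOf g (max l (min s u) - t) - (if e < max l (min s u) - t then 1 else 0)
      else 0)

end

section Innovation

theorem saturate_clamp {l u : ℝ} (h : l ≤ u) (x : ℝ) : saturate l l u u x = max l (min x u) := by
  unfold saturate
  split_ifs with h1 h2
  · rw [min_eq_left (by linarith), max_eq_left h1.le]
  · rw [min_eq_left h2, max_eq_right (not_lt.1 h1)]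
  · rw [min_eq_right (by linarith), max_eq_right h]

theorem abs_saturate_clamp_sub_le {l u : ℝ} (h : l ≤ u) (x y : ℝ) :
    |saturate l l u u x - saturate l l u u y| ≤ |x - y| := by
  rw [saturate_clamp h, saturate_clamp h]
  rw [max_comm l, max_comm l]
  exact (abs_max_sub_max_le_abs _ _ _).trans (by simpa using abs_min_sub_min_le_max x u y u)

/-- At a saturated prediction the sign takes only two values, 1 - 1{e ≤ l - t} below and -1{e < u -
t} above; in between it is 1 - 1{e ≤ s - t} - 1{e < s - t}. Replacing each indicator by its
conditional probability leaves the mean part. Weak and strict inequalities both occur because the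
sign vanishes at ties. The condition l < u prevents both corrections from acting at once. -/
theorem signInnovation_eq {g : ℝ → ℝ} {l u : ℝ} (h : l < u) (s t e : ℝ) :
    signInnovation g l l u u (saturate l l u u (t + e)) s =
      innovationMean g l u s t + innovationNoise g l u s t e := by
  unfold signInnovation innovationMean innovationNoise
  rw [saturate_clamp h.le, saturate_clamp h.le]
  rcases le_or_gt s l with hs | hs
  · have hsu : s < u := by linarith
    rw [min_eq_left hsu.le, max_eq_left hs, if_neg h.ne, if_pos rfl, if_pos hs, if_pos hsu,
      if_neg (not_lt.2 hs)]
    rcases le_or_gt e (l - t) with he | he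
    · rw [min_eq_left (by linarith), max_eq_left (by linarith), if_pos he]; simp
    · have : l < max l (min (t + e) u) := lt_max_of_lt_right (lt_min (by linarith) h)
      rw [if_neg (not_le.2 he), Real.sign_of_pos (by linarith)]; ring
  · rcases le_or_gt u s with hu | hu
    · rw [min_eq_right hu, max_eq_right h.le, if_neg h.ne', if_pos rfl, if_neg (not_le.2 hs),
        if_pos hu, if_neg (not_lt.2 hu), if_pos hs]
      rcases lt_or_ge e (u - t) with he | he
      · have : max l (min (t + e) u) < u := max_lt h (min_lt_of_left_lt (by linarith))
        rw [if_pos he, Real.sign_of_neg (by linarith)]; ring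
      · rw [min_eq_right (by linarith), max_eq_right h.le, if_neg (not_lt.2 he)]; simp
    · rw [min_eq_left hu.le, max_eq_right hs.le, if_neg hu.ne, if_neg hs.ne', if_neg (not_le.2 hs),
        if_neg (not_le.2 hu), if_pos hu, if_pos hs]
      rcases lt_trichotomy e (s - t) with he | he | he
      · have : max l (min (t + e) u) < s := max_lt hs (min_lt_of_left_lt (by linarith))
        rw [if_pos he, if_pos he.le, Real.sign_of_neg (by linarith)]; ring
      · have : max l (min (t + e) u) = s := by
          rw [he, add_sub_cancel, min_eq_left hu.le, max_eq_right hs.le]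
        rw [this, he]; simp; ring
      · have : s < max l (min (t + e) u) := lt_max_of_lt_right (lt_min (by linarith) hu)
        rw [if_neg (not_lt.2 he.le), if_neg (not_le.2 he), Real.sign_of_pos (by linarith)]; ring

variable {Ω : Type*} {m : MeasurableSpace Ω} [mΩ : MeasurableSpace Ω] {Pr : Measure Ω}
  {X : Ω → ℝ} {g : Ω → ℝ → ℝ} {l u s t : Ω → ℝ}

theorem IsMedianZeroCondDensity.abs_innovationNoise_le (hg : IsMedianZeroCondDensity Pr m X g)
    (ω : Ω) (l u s t e : ℝ) : |innovationNoise (g ω) l u s t e| ≤ 2 := by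
  have h0 := cdfOf_nonneg (hg.nonneg ω) (max l (min s u) - t)
  have h1 := cdfOf_le_one (hg.integrable ω) (hg.nonneg ω) (hg.integral_eq_one ω)
    (max l (min s u) - t)
  unfold innovationNoise
  split_ifs <;> rw [abs_le] <;> constructor <;> linarith

theorem IsMedianZeroCondDensity.measurable_innovationNoise {Ω : Type*}
    {m m' : MeasurableSpace Ω} [mΩ : MeasurableSpace Ω] {Pr : Measure Ω}
    {X : Ω → ℝ} {g : Ω → ℝ → ℝ} {l u s t : Ω → ℝ}
    (hg : IsMedianZeroCondDensity Pr m X g) (hmm : m ≤ m') (hX : Measurable[m'] X)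
    (hl : Measurable[m] l) (hu : Measurable[m] u) (hs : Measurable[m] s) (ht : Measurable[m] t) :
    Measurable[m'] fun ω => innovationNoise (g ω) (l ω) (u ω) (s ω) (t ω) (X ω) := by
  have hp : Measurable[m] fun ω => max (l ω) (min (s ω) (u ω)) - t ω :=
    (hl.max (hs.min hu)).sub ht
  have hp' := hp.mono hmm le_rfl
  have hF := (hg.measurable_cdfOf hp).mono hmm le_rfl
  unfold innovationNoise
  refine Measurable.add (Measurable.ite ?_ (hF.sub (Measurable.ite ?_ ?_ ?_)) ?_)
    (Measurable.ite ?_ (hF.sub (Measurable.ite ?_ ?_ ?_)) ?_)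
  · exact hmm _ (measurableSet_lt hs hu)
  · exact measurableSet_le hX hp'
  · exact measurable_const
  · exact measurable_const
  · exact measurable_const
  · exact hmm _ (measurableSet_lt hl hs)
  · exact measurableSet_lt hX hp'
  · exact measurable_const
  · exact measurable_const
  · exact measurable_const

/-- Each summand is a predictable indicator times a centred indicator; one compensator serves for
both the weak and the strict event. -/
theorem IsMedianZeroCondDensity.condExp_innovationNoise [IsProbabilityMeasure Pr]
    (hg : IsMedianZeroCondDensity Pr m X g) (hm : m ≤ mΩ) (hX : Measurable X)
    (hl : Measurable[m] l) (hu : Measurable[m] u) (hs : Measurable[m] s) (ht : Measurable[m] t) :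
    Pr[fun ω => innovationNoise (g ω) (l ω) (u ω) (s ω) (t ω) (X ω) | m] =ᵐ[Pr] 0 := by
  set x : Ω → ℝ := fun ω => max (l ω) (min (s ω) (u ω)) - t ω with hxdef
  have hx : Measurable[m] x := (hl.max (hs.min hu)).sub ht
  have hFi : Integrable (fun ω => cdfOf (g ω) (x ω)) Pr := Integrable.of_bound
      ((hg.measurable_cdfOf hx).mono hm le_rfl).aestronglyMeasurable 1
      (Eventually.of_forall fun ω => hg.abs_cdfOf_le ω _)
  have hF : Pr[fun ω => cdfOf (g ω) (x ω) | m] = fun ω => cdfOf (g ω) (x ω) :=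
    condExp_of_stronglyMeasurable hm (hg.measurable_cdfOf hx).stronglyMeasurable hFi
  have key : ∀ S : Set Ω, MeasurableSet S →
      Pr[S.indicator (fun _ => (1 : ℝ)) | m] =ᵐ[Pr] (fun ω => cdfOf (g ω) (x ω)) →
      ∀ A : Set Ω, MeasurableSet[m] A →
      Integrable (A.indicator ((fun ω => cdfOf (g ω) (x ω)) - S.indicator fun _ => (1 : ℝ))) Pr ∧
      Pr[A.indicator ((fun ω => cdfOf (g ω) (x ω)) - S.indicator fun _ => (1 : ℝ)) | m]
        =ᵐ[Pr] 0 := by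
    intro S hS h A hA
    have hSi : Integrable (S.indicator fun _ => (1 : ℝ)) Pr := (integrable_const 1).indicator hS
    refine ⟨(hFi.sub hSi).indicator (hm _ hA), ?_⟩
    filter_upwards [condExp_indicator (μ := Pr) (m := m) (hFi.sub hSi) hA,
      condExp_sub hFi hSi m, h] with ω h1 h2 h3
    rw [h1]
    by_cases hω : ω ∈ A
    · rw [indicator_of_mem hω, h2, Pi.sub_apply, hF, h3]; simp
    · rw [indicator_of_notMem hω]; rfl
  have k1 := key _ (measurableSet_le hX (hx.mono hm le_rfl))
    (hg.condExp_indicator_le hX hx hm) _ (measurableSet_lt hs hu)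
  have k2 := key _ (measurableSet_lt hX (hx.mono hm le_rfl))
    (hg.condExp_indicator_lt hX hx hm) _ (measurableSet_lt hl hs)
  have e : (fun ω => innovationNoise (g ω) (l ω) (u ω) (s ω) (t ω) (X ω)) =
      {ω | s ω < u ω}.indicator ((fun ω => cdfOf (g ω) (x ω)) -
        {ω | X ω ≤ x ω}.indicator fun _ => (1 : ℝ)) +
      {ω | l ω < s ω}.indicator ((fun ω => cdfOf (g ω) (x ω)) -
        {ω | X ω < x ω}.indicator fun _ => (1 : ℝ)) := by
    ext ω
    simp [innovationNoise, indicator, hxdef]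
  rw [e]
  filter_upwards [condExp_add k1.1 k2.1 m, k1.2, k2.2] with ω h1 h2 h3
  rw [h1, Pi.add_apply, h2, h3]; simp

end Innovation

/-! ### Weighted projections onto a convex compact set. -/

section Projection

variable {d : ℕ} {Q : Matrix (Fin d) (Fin d) ℝ} {D : Set (Fin d → ℝ)}

theorem Matrix.IsHermitian.dotProduct_mulVec_comm (hQ : Q.IsHermitian) (x y : Fin d → ℝ) :
    x ⬝ᵥ (Q *ᵥ y) = y ⬝ᵥ (Q *ᵥ x) := by
  have hT : Qᵀ = Q := by simpa [Matrix.IsHermitian] using hQ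
  rw [dotProduct_mulVec, ← mulVec_transpose, hT, dotProduct_comm]

theorem Matrix.PosSemidef.dotProduct_mulVec_self_nonneg (hQ : Q.PosSemidef) (x : Fin d → ℝ) :
    0 ≤ x ⬝ᵥ (Q *ᵥ x) := by simpa using hQ.dotProduct_mulVec_nonneg x

theorem Matrix.PosDef.dotProduct_mulVec_self_pos (hQ : Q.PosDef) {x : Fin d → ℝ} (hx : x ≠ 0) :
    0 < x ⬝ᵥ (Q *ᵥ x) := by simpa using hQ.dotProduct_mulVec_pos hx

theorem Matrix.IsHermitian.quadratic_sub_smul (hQ : Q.IsHermitian) (x y : Fin d → ℝ) (c : ℝ) :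
    (x - c • y) ⬝ᵥ (Q *ᵥ (x - c • y)) =
      x ⬝ᵥ (Q *ᵥ x) - 2 * c * (y ⬝ᵥ (Q *ᵥ x)) + c ^ 2 * (y ⬝ᵥ (Q *ᵥ y)) := by
  rw [mulVec_sub, mulVec_smul, sub_dotProduct, dotProduct_sub, dotProduct_sub, smul_dotProduct,
    smul_dotProduct, dotProduct_smul, dotProduct_smul, hQ.dotProduct_mulVec_comm x y]
  simp only [smul_eq_mul]
  ring

theorem isWeightedProj_iff (hQ : Q.PosSemidef) {x z : Fin d → ℝ} :
    IsWeightedProj D Q x z ↔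
      z ∈ D ∧ ∀ y ∈ D, (x - z) ⬝ᵥ (Q *ᵥ (x - z)) ≤ (x - y) ⬝ᵥ (Q *ᵥ (x - y)) := by
  unfold IsWeightedProj weightedNorm
  refine and_congr_right fun _ => forall₂_congr fun y _ => ?_
  exact Real.sqrt_le_sqrt_iff (hQ.dotProduct_mulVec_self_nonneg _)

/-- The variational inequality of the projection. -/
theorem IsWeightedProj.inner_nonpos (hQ : Q.PosSemidef) (hD : Convex ℝ D) {x z y : Fin d → ℝ}
    (h : IsWeightedProj D Q x z) (hy : y ∈ D) : (y - z) ⬝ᵥ (Q *ᵥ (x - z)) ≤ 0 := by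
  obtain ⟨hz, hmin⟩ := (isWeightedProj_iff hQ).1 h
  set A := (y - z) ⬝ᵥ (Q *ᵥ (x - z)) with hA
  set B := (y - z) ⬝ᵥ (Q *ᵥ (y - z)) with hB
  have hB0 : 0 ≤ B := hQ.dotProduct_mulVec_self_nonneg _
  have key : ∀ c : ℝ, 0 < c → c ≤ 1 → 2 * A ≤ c * B := by
    intro c hc hc1
    have hmem : z + c • (y - z) ∈ D := hD.add_smul_sub_mem hz hy ⟨hc.le, hc1⟩
    have h1 := hmin _ hmem
    have e : x - (z + c • (y - z)) = (x - z) - c • (y - z) := by abel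
    rw [e, hQ.1.quadratic_sub_smul] at h1
    rw [← hA, ← hB] at h1
    have h2 : c * (2 * A) ≤ c * (c * B) := by linarith
    exact le_of_mul_le_mul_left h2 hc
  by_contra hcon
  push Not at hcon
  -- With this step length cB ≤ A, which contradicts 2A ≤ cB when A > 0.
  have hc : 0 < min 1 (A / (B + 1)) := by positivity
  have h1 := key _ hc (min_le_left _ _)
  have h2 : min 1 (A / (B + 1)) * B ≤ A / (B + 1) * B :=
    mul_le_mul_of_nonneg_right (min_le_right _ _) hB0
  have h3 : A / (B + 1) * B ≤ A := by
    rw [div_mul_eq_mul_div, div_le_iff₀ (by positivity)]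
    nlinarith
  linarith

/-- The projection does not increase the weighted distance to points of the convex set. -/
theorem IsWeightedProj.dist_le (hQ : Q.PosSemidef) (hD : Convex ℝ D) {x z y : Fin d → ℝ}
    (h : IsWeightedProj D Q x z) (hy : y ∈ D) :
    (y - z) ⬝ᵥ (Q *ᵥ (y - z)) ≤ (y - x) ⬝ᵥ (Q *ᵥ (y - x)) := by
  have h1 := h.inner_nonpos hQ hD hy
  have h2 := hQ.dotProduct_mulVec_self_nonneg (x - z)
  have e : y - x = (y - z) - (1 : ℝ) • (x - z) := by rw [one_smul]; abel
  rw [e, hQ.1.quadratic_sub_smul, hQ.1.dotProduct_mulVec_comm (x - z) (y - z)]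
  linarith

/-- Adding the variational inequalities at z and z' forces the weighted norm of z - z' to vanish. -/
theorem IsWeightedProj.unique (hQ : Q.PosDef) (hD : Convex ℝ D) {x z z' : Fin d → ℝ}
    (h : IsWeightedProj D Q x z) (h' : IsWeightedProj D Q x z') : z = z' := by
  by_contra hne
  have h1 := h.inner_nonpos hQ.posSemidef hD h'.1
  have h2 := h'.inner_nonpos hQ.posSemidef hD h.1
  have h3 := hQ.dotProduct_mulVec_self_pos (sub_ne_zero.2 hne)
  have e1 : x - z = (x - z') - (z - z') := by abel
  have e2 : z' - z = -(z - z') := by abel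
  rw [e1, e2, mulVec_sub, dotProduct_sub, neg_dotProduct, neg_dotProduct] at h1
  linarith

/-- The weighted projection depends measurably on the point and the inverse weight. -/
theorem measurable_of_isWeightedProj {Ω : Type*} {m : MeasurableSpace Ω} (hD : Convex ℝ D)
    (hDc : IsCompact D) {x z : Ω → Fin d → ℝ} {R : Ω → Matrix (Fin d) (Fin d) ℝ}
    (hx : Measurable x) (hR : ∀ i j, Measurable fun ω => R ω i j) (hRpos : ∀ ω, (R ω).PosDef)
    (h : ∀ ω, IsWeightedProj D (R ω)⁻¹ (x ω) (z ω)) : Measurable z := by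
  classical
  rcases D.eq_empty_or_nonempty with rfl | ⟨z₀, hz₀⟩
  · have : IsEmpty Ω := ⟨fun ω => (h ω).1⟩
    exact measurable_of_empty z
  -- On the positive definite matrices inversion is continuous, so the graph of the projection is
  -- closed in T × D.
  let T := {p : (Fin d → Fin d → ℝ) × (Fin d → ℝ) // (Matrix.of p.1).PosDef}
  have : CompactSpace D := isCompact_iff_compactSpace.1 hDc
  have hinv : Continuous fun t : T => (Matrix.of t.1.1)⁻¹ := by
    simp only [Matrix.inv_def, Ring.inverse_eq_inv']
    have h1 : Continuous fun t : T => Matrix.of t.1.1 := continuous_fst.comp continuous_subtype_val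
    exact (h1.matrix_det.inv₀ fun t => t.2.det_pos.ne').smul h1.matrix_adjugate
  let G : Set (T × D) := {q | IsWeightedProj D (Matrix.of q.1.1.1)⁻¹ q.1.1.2 q.2}
  have hG : IsClosed G := by
    have e : G = ⋂ y ∈ D, {q : T × D |
        weightedNorm (Matrix.of q.1.1.1)⁻¹ (q.1.1.2 - q.2) ≤
          weightedNorm (Matrix.of q.1.1.1)⁻¹ (q.1.1.2 - y)} := by
      ext q
      simp [G, IsWeightedProj]
    rw [e]
    refine isClosed_biInter fun y _ => isClosed_le ?_ ?_
    all_goals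
      unfold weightedNorm
      have h1 : Continuous fun q : T × D => (Matrix.of q.1.1.1)⁻¹ := hinv.comp continuous_fst
      have h2 : Continuous fun q : T × D => q.1.1.2 :=
        continuous_snd.comp (continuous_subtype_val.comp continuous_fst)
    · have h3 : Continuous fun q : T × D => q.1.1.2 - (q.2 : Fin d → ℝ) :=
        h2.sub (continuous_subtype_val.comp continuous_snd)
      exact (h3.dotProduct (h1.matrix_mulVec h3)).sqrt
    · have h3 : Continuous fun q : T × D => q.1.1.2 - y := h2.sub continuous_const
      exact (h3.dotProduct (h1.matrix_mulVec h3)).sqrt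
  let t : Ω → T := fun ω => ⟨(fun i j => R ω i j, x ω), hRpos ω⟩
  have ht : Measurable t := by
    refine Measurable.subtype_mk (Measurable.prodMk ?_ hx)
    exact measurable_pi_lambda _ fun i => measurable_pi_lambda _ fun j => hR i j
  have hzD : Measurable fun ω => (⟨z ω, (h ω).1⟩ : D) := by
    refine measurable_of_isClosed fun K hK => ?_
    -- Uniqueness identifies the preimage of K with the t-preimage of a projected graph. Since D is
    -- compact, projecting along it maps closed sets to closed sets.
    have e : (fun ω => (⟨z ω, (h ω).1⟩ : D)) ⁻¹' K =
        t ⁻¹' (Prod.fst '' (G ∩ Prod.snd ⁻¹' K)) := by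
      ext ω
      constructor
      · intro hω
        exact ⟨(t ω, ⟨z ω, (h ω).1⟩), ⟨h ω, hω⟩, rfl⟩
      · rintro ⟨⟨q, z'⟩, ⟨hq, hz'⟩, hqt⟩
        simp only at hqt
        subst hqt
        have := IsWeightedProj.unique (hRpos ω).inv hD (h ω) hq
        have e2 : (⟨z ω, (h ω).1⟩ : D) = z' := Subtype.ext this
        change (⟨z ω, (h ω).1⟩ : D) ∈ K
        rw [e2]; exact hz'
    rw [e]
    exact ht (isClosedMap_fst_of_compactSpace _
      (hG.inter (hK.preimage continuous_snd))).measurableSet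
  exact measurable_subtype_coe.comp hzD

end Projection

/-! ### One step of the recursion: rank-one update and energy inequality. -/

section RecursiveStep

variable {d : ℕ} {D : Set (Fin d → ℝ)} {m β b v : ℝ} {φ ϑ ϑ' : Fin d → ℝ}
  {P P' : Matrix (Fin d) (Fin d) ℝ}

theorem Matrix.PosDef.mul_vecMulVec_mul (hP : P.PosDef) (φ : Fin d → ℝ) :
    P * vecMulVec φ φ * P = vecMulVec (P *ᵥ φ) (P *ᵥ φ) := by
  have hT : Pᵀ = P := by simpa [Matrix.IsHermitian] using hP.1
  rw [mul_vecMulVec, vecMulVec_mul, ← mulVec_transpose, hT]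

/-- The rank one update of the gain matrix adds a rank one term to its inverse. -/
theorem IsRecursiveStep.inv_eq (hP : P.PosDef) (hm : 0 < m) (hβ : 0 ≤ β)
    (h : IsRecursiveStep D m β b v φ ϑ P ϑ' P') :
    P'.PosDef ∧ P'⁻¹ = P⁻¹ + (β * b ^ 2 / m) • vecMulVec φ φ ∧
      stepSize m β b φ P • (P *ᵥ φ) = (1 / m) • (P' *ᵥ φ) ∧
      (β * b ^ 2 / m) * (φ ⬝ᵥ (P' *ᵥ φ)) = 1 - P⁻¹.det / P'⁻¹.det := by
  obtain ⟨hP', -⟩ := h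
  set γ := β * b ^ 2 / m with hγ
  have hγ0 : 0 ≤ γ := by positivity
  set q := φ ⬝ᵥ (P *ᵥ φ) with hq
  have hq0 : 0 ≤ q := hP.posSemidef.dotProduct_mulVec_self_nonneg φ
  have hu : IsUnit P.det := (Matrix.isUnit_iff_isUnit_det _).1 hP.isUnit
  have h1q : 0 < 1 + γ * q := by positivity
  have hβb : β * b ^ 2 = γ * m := by rw [hγ]; field_simp
  have hstep : stepSize m β b φ P = 1 / (m * (1 + γ * q)) := by
    unfold stepSize; rw [hβb, ← hq]; congr 1; ring
  have hκ : stepSize m β b φ P * β * b ^ 2 = γ / (1 + γ * q) := by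
    rw [mul_assoc, hβb, hstep]; field_simp
  rw [hκ, hP.mul_vecMulVec_mul] at hP'
  -- The Sherman–Morrison identity, checked by multiplication.
  have hmul : P' * (P⁻¹ + γ • vecMulVec φ φ) = 1 := by
    have hT : P⁻¹ᵀ = P⁻¹ := by simpa [Matrix.IsHermitian] using hP.inv.1
    have e1 : vecMulVec (P *ᵥ φ) (P *ᵥ φ) * P⁻¹ = vecMulVec (P *ᵥ φ) φ := by
      rw [vecMulVec_mul, ← mulVec_transpose, hT, mulVec_mulVec, nonsing_inv_mul _ hu, one_mulVec]
    have e2 : vecMulVec (P *ᵥ φ) (P *ᵥ φ) * vecMulVec φ φ = q • vecMulVec (P *ᵥ φ) φ := by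
      rw [vecMulVec_mul_vecMulVec, dotProduct_comm, ← hq]
      ext i j; simp [vecMulVec_apply]; ring
    rw [hP', Matrix.sub_mul, Matrix.mul_add, Matrix.mul_add, mul_nonsing_inv _ hu,
      Matrix.smul_mul, Matrix.smul_mul, e1, Matrix.mul_smul, Matrix.mul_smul, e2, mul_vecMulVec]
    have : γ - γ / (1 + γ * q) - γ / (1 + γ * q) * γ * q = 0 := by field_simp; ring
    ext i j
    simp only [Matrix.sub_apply, Matrix.add_apply, Matrix.smul_apply, smul_eq_mul]
    linear_combination (vecMulVec (P *ᵥ φ) φ i j) * this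
  have hinv : P'⁻¹ = P⁻¹ + γ • vecMulVec φ φ := Matrix.inv_eq_right_inv hmul
  have hQpos : (P⁻¹ + γ • vecMulVec φ φ).PosDef := by
    refine hP.inv.add_posSemidef ?_
    have := posSemidef_vecMulVec_self_star φ
    exact (by simpa using this : (vecMulVec φ φ).PosSemidef).smul hγ0
  have hpos : P'.PosDef := by
    rw [← Matrix.posDef_inv_iff, hinv]; exact hQpos
  have hPφ : P' *ᵥ φ = (1 / (1 + γ * q)) • (P *ᵥ φ) := by
    rw [hP', sub_mulVec, smul_mulVec, vecMulVec_mulVec, dotProduct_comm, ← hq]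
    ext i
    simp only [Pi.sub_apply, Pi.smul_apply, smul_eq_mul, MulOpposite.smul_eq_mul_unop,
      MulOpposite.unop_op]
    field_simp
    ring
  refine ⟨hpos, hinv, ?_, ?_⟩
  · rw [hPφ, hstep, smul_smul]; congr 1; field_simp
  -- By the matrix determinant lemma; then γ φᵀP'φ = γq/(1 + γq) = 1 - 1/(1 + γq) is one minus the
  -- determinant ratio.
  · have hdet : P'⁻¹.det = P⁻¹.det * (1 + γ * q) := by
      rw [hinv, ← smul_vecMulVec, vecMulVec_eq Unit,
        det_add_replicateCol_mul_replicateRow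
          ((Matrix.isUnit_iff_isUnit_det _).1 hP.inv.isUnit), nonsing_inv_nonsing_inv _ hu]
      congr 1
      have e : replicateRow Unit φ * P * replicateCol Unit (γ • φ) =
          Matrix.of fun _ _ => γ * q := by
        ext i j
        rw [Matrix.mul_assoc]
        simp only [Matrix.mul_apply, replicateRow_apply, replicateCol_apply,
          Pi.smul_apply, smul_eq_mul, hq, dotProduct, mulVec, of_apply, Finset.mul_sum]
        refine Finset.sum_congr rfl fun i _ => Finset.sum_congr rfl fun j _ => by ring
      rw [e, det_unique]
      simp
    have hd : 0 < P⁻¹.det := hP.inv.det_pos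
    rw [hdet, hPφ, dotProduct_smul, ← hq, smul_eq_mul]
    field_simp
    ring

/-- One-step energy inequality for the weighted squared estimation error. -/
theorem IsRecursiveStep.energy_le (hP : P.PosDef) (hm : 0 < m) (hβ : 0 ≤ β)
    (hD : Convex ℝ D) {θ : Fin d → ℝ} (hθ : θ ∈ D)
    (h : IsRecursiveStep D m β b v φ ϑ P ϑ' P') :
    (θ - ϑ') ⬝ᵥ (P'⁻¹ *ᵥ (θ - ϑ')) ≤ (θ - ϑ) ⬝ᵥ (P⁻¹ *ᵥ (θ - ϑ)) +
      β * b ^ 2 / m * (φ ⬝ᵥ θ - φ ⬝ᵥ ϑ) ^ 2 - 2 * (b * v / m) * (φ ⬝ᵥ θ - φ ⬝ᵥ ϑ) +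
      (b * v / m) ^ 2 * (φ ⬝ᵥ (P' *ᵥ φ)) := by
  obtain ⟨hpos, hinv, hstep, -⟩ := h.inv_eq hP hm hβ
  have hu : IsUnit P'.det := (Matrix.isUnit_iff_isUnit_det _).1 hpos.isUnit
  refine (h.2.dist_le hpos.inv.posSemidef hD hθ).trans (le_of_eq ?_)
  -- Rewriting the increment along P'φ lets P'⁻¹ cancel in the cross term, which becomes the scalar
  -- prediction error.
  have e1 : θ - (ϑ + (stepSize m β b φ P * b * v) • (P *ᵥ φ)) =
      (θ - ϑ) - (b * v / m) • (P' *ᵥ φ) := by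
    have : (stepSize m β b φ P * b * v) • (P *ᵥ φ) = (b * v / m) • (P' *ᵥ φ) := by
      have e : stepSize m β b φ P * b * v = (b * v) * stepSize m β b φ P := by ring
      rw [e, mul_smul, hstep, smul_smul]; congr 1; ring
    rw [this]; abel
  have e2 : P'⁻¹ *ᵥ (P' *ᵥ φ) = φ := by
    rw [mulVec_mulVec, nonsing_inv_mul _ hu, one_mulVec]
  have e3 : (θ - ϑ) ⬝ᵥ φ = φ ⬝ᵥ θ - φ ⬝ᵥ ϑ := by
    rw [dotProduct_comm, dotProduct_sub]
  have e4 : (θ - ϑ) ⬝ᵥ (P'⁻¹ *ᵥ (θ - ϑ)) = (θ - ϑ) ⬝ᵥ (P⁻¹ *ᵥ (θ - ϑ)) +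
      β * b ^ 2 / m * (φ ⬝ᵥ θ - φ ⬝ᵥ ϑ) ^ 2 := by
    rw [hinv, add_mulVec, dotProduct_add, smul_mulVec, dotProduct_smul, vecMulVec_mulVec,
      ← e3, dotProduct_comm φ (θ - ϑ)]
    rw [op_smul_eq_smul, dotProduct_smul]
    simp only [smul_eq_mul]; ring
  rw [e1, hpos.inv.1.quadratic_sub_smul, hpos.inv.1.dotProduct_mulVec_comm (P' *ᵥ φ), e2, e3, e4,
    dotProduct_comm (P' *ᵥ φ) φ]

end RecursiveStep

/-! ### Monotonicity of the mean innovation, gains and drift. -/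

section Drift

theorem saturate_eq_lower_iff {l u : ℝ} (h : l < u) (s : ℝ) : saturate l l u u s = l ↔ s ≤ l := by
  rw [saturate_clamp h.le, max_eq_left_iff, min_le_iff]
  exact ⟨fun h' => h'.resolve_right (not_le.2 h), Or.inl⟩

theorem saturate_eq_upper_iff {l u : ℝ} (h : l < u) (s : ℝ) : saturate l l u u s = u ↔ u ≤ s := by
  rw [saturate_clamp h.le]
  constructor
  · intro h'
    by_contra hs
    have : max l (min s u) < u := max_lt h (min_lt_of_left_lt (not_le.1 hs))
    exact this.ne h'
  · intro h'
    rw [min_eq_right h', max_eq_right h.le]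

variable {g : ℝ → ℝ}

theorem mul_sq_le_cdfOf_sub_mul (hi : Integrable g) {x y h : ℝ} (hg : ∀ z ∈ uIcc x y, h ≤ g z) :
    h * (y - x) ^ 2 ≤ (cdfOf g y - cdfOf g x) * (y - x) := by
  rcases le_total x y with hxy | hxy
  · have := mul_sub_le_cdfOf_sub hi hxy fun z hz => hg z (by rwa [uIcc_of_le hxy])
    nlinarith [sub_nonneg.2 hxy]
  · have := mul_sub_le_cdfOf_sub hi hxy fun z hz => hg z (by rwa [uIcc_of_ge hxy])
    nlinarith [sub_nonneg.2 hxy]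

theorem mem_abs_le_of_mem_uIcc {x y z ρ : ℝ} (hx : |x| ≤ ρ) (hy : |y| ≤ ρ) (hz : z ∈ uIcc x y) :
    |z| ≤ ρ := by
  rw [abs_le] at *
  exact ⟨(le_inf hx.1 hy.1).trans hz.1, hz.2.trans (sup_le hx.2 hy.2)⟩

/-- The arguments of the density that occur for parameters bounded by `c`. -/
theorem innovation_argument_bounds {l u s c : ℝ} (hs : |s| ≤ c) :
    (s ≤ l → ∀ x, |x| ≤ c → |l - x| ≤ max (2 * c) (max (c + l) (c - u))) ∧
      (u ≤ s → ∀ x, |x| ≤ c → |u - x| ≤ max (2 * c) (max (c + l) (c - u))) ∧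
      ∀ x, |x| ≤ c → |s - x| ≤ max (2 * c) (max (c + l) (c - u)) := by
  have h1 := le_max_left (2 * c) (max (c + l) (c - u))
  have h2 := (le_max_left (c + l) (c - u)).trans (le_max_right (2 * c) _)
  have h3 := (le_max_right (c + l) (c - u)).trans (le_max_right (2 * c) _)
  rw [abs_le] at hs
  -- The branch condition supplies the missing side: s ≤ l gives l - x ≥ s - x ≥ -2c, and u ≤ s
  -- gives u - x ≤ 2c.
  refine ⟨fun h x hx => ?_, fun h x hx => ?_, fun x hx => ?_⟩ <;>
    rw [abs_le] at hx ⊢ <;> constructor <;> linarith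

theorem innovationMean_self (hmed : cdfOf g 0 = 1 / 2) (l u s : ℝ) :
    innovationMean g l u s s = 0 := by
  unfold innovationMean
  split_ifs <;> simp [hmed]

/-- Strong monotonicity of the mean innovation. -/
theorem mul_sq_le_innovationMean_mul (hi : Integrable g) (hmed : cdfOf g 0 = 1 / 2)
    {l u s t c h : ℝ} (hs : |s| ≤ c) (ht : |t| ≤ c) (h0 : 0 ≤ h)
    (hg : ∀ x, |x| ≤ max (2 * c) (max (c + l) (c - u)) → h ≤ g x) :
    h * (t - s) ^ 2 ≤ innovationMean g l u s t * (t - s) := by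
  obtain ⟨hl, hu, hmid⟩ := innovation_argument_bounds (l := l) (u := u) hs
  unfold innovationMean
  split_ifs with h1 h2
  · have := mul_sq_le_cdfOf_sub_mul hi (x := l - t) (y := l - s) (h := h) fun z hz =>
      hg z (mem_abs_le_of_mem_uIcc (hl h1 t ht) (hl h1 s hs) hz)
    have e : l - s - (l - t) = t - s := by ring
    rwa [e] at this
  · have := mul_sq_le_cdfOf_sub_mul hi (x := u - t) (y := u - s) (h := h) fun z hz =>
      hg z (mem_abs_le_of_mem_uIcc (hu h2 t ht) (hu h2 s hs) hz)
    have e : u - s - (u - t) = t - s := by ring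
    rwa [e] at this
  -- Since the median is zero, 1 - 2F(s - t) = 2(F(0) - F(s - t)), twice the required increment.
  · have := mul_sq_le_cdfOf_sub_mul hi (x := s - t) (y := 0) (h := h) fun z hz =>
      hg z (mem_abs_le_of_mem_uIcc (hmid t ht) (by simpa using hmid s hs) hz)
    rw [hmed] at this
    nlinarith [mul_nonneg h0 (sq_nonneg (t - s))]

/-- Lipschitz continuity of the mean innovation in the true output. -/
theorem abs_innovationMean_sub_le (hi : Integrable g) (hg0 : ∀ x, 0 ≤ g x)
    {l u s t t' c H : ℝ} (hs : |s| ≤ c) (ht : |t| ≤ c) (ht' : |t'| ≤ c) (hH : 0 ≤ H)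
    (hg : ∀ x, |x| ≤ max (2 * c) (max (c + l) (c - u)) → g x ≤ H) :
    |innovationMean g l u s t - innovationMean g l u s t'| ≤ 2 * H * |t - t'| := by
  obtain ⟨hl, hu, hmid⟩ := innovation_argument_bounds (l := l) (u := u) hs
  have key : ∀ a : ℝ, (∀ x, |x| ≤ c → |a - x| ≤ max (2 * c) (max (c + l) (c - u))) →
      |cdfOf g (a - t') - cdfOf g (a - t)| ≤ H * |t - t'| := by
    intro a ha
    have := abs_cdfOf_sub_le hi hg0 (a := a - t) (b := a - t') (H := H) fun z hz =>
      hg z (mem_abs_le_of_mem_uIcc (ha t ht) (ha t' ht') hz)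
    have e : a - t' - (a - t) = t - t' := by ring
    rwa [e] at this
  have hp : 0 ≤ H * |t - t'| := by positivity
  unfold innovationMean
  split_ifs with h1 h2
  · have e : cdfOf g (l - s) - cdfOf g (l - t) - (cdfOf g (l - s) - cdfOf g (l - t')) =
      cdfOf g (l - t') - cdfOf g (l - t) := by ring
    rw [e]; linarith [key l (hl h1)]
  · have e : cdfOf g (u - s) - cdfOf g (u - t) - (cdfOf g (u - s) - cdfOf g (u - t')) =
      cdfOf g (u - t') - cdfOf g (u - t) := by ring
    rw [e]; linarith [key u (hu h2)]
  · have e : 1 - 2 * cdfOf g (s - t) - (1 - 2 * cdfOf g (s - t')) =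
      2 * (cdfOf g (s - t') - cdfOf g (s - t)) := by ring
    rw [e, abs_mul, abs_two]; linarith [key s hmid]

/-- True even for an empty index set, where the real infimum is 0. The sign is needed at every
sample point, to keep the gain matrices positive definite there. -/
theorem prelimBeta_nonneg (hg0 : ∀ x, 0 ≤ g x) (l u c : ℝ) : 0 ≤ prelimBeta g l u c :=
  Real.sInf_nonneg (by rintro _ ⟨x, -, rfl⟩; exact hg0 x)

theorem prelimBeta_le (hg0 : ∀ x, 0 ≤ g x) {l u c x : ℝ}
    (hx : |x| ≤ max (2 * c) (max (c + l) (c - u))) : prelimBeta g l u c ≤ g x :=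
  csInf_le ⟨0, by rintro _ ⟨x, -, rfl⟩; exact hg0 x⟩ ⟨x, hx, rfl⟩

theorem le_prelimBeta {l u c h : ℝ} (hc : 0 ≤ c)
    (hg : ∀ x, |x| ≤ max (2 * c) (max (c + l) (c - u)) → h ≤ g x) : h ≤ prelimBeta g l u c :=
  le_csInf ⟨g 0, 0, by simp [hc], rfl⟩ (by rintro _ ⟨x, hx, rfl⟩; exact hg x hx)

/-- Every branch is a density value or a difference quotient of a nondecreasing function, up to a
factor 2. No order of the thresholds enters, so it applies on all of Ω and not merely almost surely.
-/
theorem accelBeta_nonneg (hi : Integrable g) (hg0 : ∀ x, 0 ≤ g x) (hmed : cdfOf g 0 = 1 / 2)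
    (L l u U s sBar : ℝ) : 0 ≤ accelBeta g L l u U s sBar := by
  have hmono := monotone_cdfOf hi hg0
  have key : ∀ a x y : ℝ, 0 ≤ a → (0 ≤ y - x → 0 ≤ a * (cdfOf g y - cdfOf g x)) ∧
      (y - x ≤ 0 → a * (cdfOf g y - cdfOf g x) ≤ 0) := fun a x y ha =>
    ⟨fun h => mul_nonneg ha (sub_nonneg.2 (hmono (sub_nonneg.1 h))), fun h =>
      mul_nonpos_of_nonneg_of_nonpos ha (sub_nonpos.2 (hmono (sub_nonpos.1 h)))⟩
  have hdiv : ∀ a x y z : ℝ, 0 ≤ a → y - x = z → 0 ≤ a * (cdfOf g y - cdfOf g x) / z := by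
    intro a x y z ha hz
    rcases le_total 0 z with h | h
    · exact div_nonneg ((key a x y ha).1 (hz ▸ h)) h
    · exact div_nonneg_of_nonpos ((key a x y ha).2 (hz ▸ h)) h
  unfold accelBeta
  split_ifs
  · simpa using hdiv 1 (l - sBar) (l - s) (sBar - s) zero_le_one (by ring)
  · exact hg0 _
  · simpa using hdiv 1 (u - sBar) (u - s) (sBar - s) zero_le_one (by ring)
  · exact hg0 _
  · have := hdiv 2 (s - sBar) 0 (sBar - s) zero_le_two (by ring)
    rw [hmed] at this
    convert this using 2; ring
  · linarith [hg0 0]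

/-- The gain of the accelerated step is the difference quotient of the mean innovation. -/
theorem accelBeta_mul_sub (hmed : cdfOf g 0 = 1 / 2) {l u : ℝ} (h : l < u) (s sBar : ℝ) :
    accelBeta g l l u u s sBar * (sBar - s) = innovationMean g l u s sBar := by
  by_cases hd : sBar - s = 0
  · have : sBar = s := by linarith
    subst this
    rw [innovationMean_self hmed]; simp
  · unfold accelBeta innovationMean
    simp only [saturate_eq_lower_iff h, saturate_eq_upper_iff h, ne_eq, hd, not_false_eq_true,
      if_true]
    split_ifs <;> rw [div_mul_cancel₀ _ hd]

/-- For sBar ≠ s, strong monotonicity and the Lipschitz bound of the mean innovation at t = sBar are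
divided by the increment. The factor 2 comes from the unsaturated branch. -/
theorem accelBeta_bounds (hi : Integrable g) (hg0 : ∀ x, 0 ≤ g x) (hmed : cdfOf g 0 = 1 / 2)
    {l u s sBar c h H : ℝ} (hlu : l < u) (hs : |s| ≤ c) (hsB : |sBar| ≤ c) (h0 : 0 ≤ h)
    (hg : ∀ x, |x| ≤ max (2 * c) (max (c + l) (c - u)) → h ≤ g x ∧ g x ≤ H) :
    h ≤ accelBeta g l l u u s sBar ∧ accelBeta g l l u u s sBar ≤ 2 * H := by
  have hH : 0 ≤ H := by
    have := hg 0 (by rw [abs_zero]; exact le_max_of_le_left (by linarith [abs_nonneg s]))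
    linarith
  by_cases hd : sBar - s = 0
  · obtain ⟨hl, hu, hmid⟩ := innovation_argument_bounds (l := l) (u := u) hs
    unfold accelBeta
    simp only [saturate_eq_lower_iff hlu, saturate_eq_upper_iff hlu, ne_eq, hd, not_true_eq_false,
      if_false]
    split_ifs with h1 h2
    · have := hg _ (hl h1 s hs); constructor <;> linarith
    · have := hg _ (hu h2 s hs); constructor <;> linarith
    · have := hg 0 (by simpa using hmid s hs); constructor <;> linarith
  · have e := accelBeta_mul_sub hmed hlu s sBar
    have h1 := mul_sq_le_innovationMean_mul hi hmed hs hsB h0 fun x hx => (hg x hx).1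
    have h2 := abs_innovationMean_sub_le hi hg0 hs hsB hs hH fun x hx => (hg x hx).2
    rw [innovationMean_self hmed, sub_zero, ← e, abs_mul] at h2
    have h3 := le_of_mul_le_mul_right h2 (abs_pos.2 hd)
    rw [← e, mul_assoc, ← sq] at h1
    exact ⟨le_of_mul_le_mul_right h1 (by positivity), (le_abs_self _).trans h3⟩

/-- Drift of the preliminary step. -/
theorem prelim_drift_le (hi : Integrable g) (hg0 : ∀ x, 0 ≤ g x) (hmed : cdfOf g 0 = 1 / 2)
    {l u s t c b b₀ h : ℝ} (hs : |s| ≤ c) (ht : |t| ≤ c) (hb₀ : b₀ ≤ b) (hb0 : 0 ≤ b) (hb1 : b ≤ 1)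
    (h0 : 0 ≤ h) (hβ : h ≤ prelimBeta g l u c) :
    prelimBeta g l u c * b ^ 2 * (t - s) ^ 2 - 2 * b * innovationMean g l u s t * (t - s) ≤
      -(b₀ * h) * (t - s) ^ 2 := by
  have h1 := mul_sq_le_innovationMean_mul hi hmed hs ht (prelimBeta_nonneg hg0 l u c)
    fun x hx => prelimBeta_le hg0 hx
  set β := prelimBeta g l u c
  have hx := sq_nonneg (t - s)
  have hβx : 0 ≤ β * (t - s) ^ 2 := mul_nonneg (h0.trans hβ) hx
  -- Since b ≤ 1, the quadratic term uses up only one of the two copies of bβ(t - s)² supplied by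
  -- monotonicity.
  have h2 : b ^ 2 * (β * (t - s) ^ 2) ≤ b * (β * (t - s) ^ 2) :=
    mul_le_mul_of_nonneg_right (by nlinarith) hβx
  have h3 := mul_le_mul_of_nonneg_left h1 hb0
  have h4 : b₀ * h * (t - s) ^ 2 ≤ b * β * (t - s) ^ 2 := by
    refine mul_le_mul_of_nonneg_right ?_ hx
    exact mul_le_mul hb₀ hβ h0 hb0
  nlinarith

/-- Drift of the accelerated step: up to the squared error of the preliminary prediction it
contracts the squared prediction error. -/
theorem accel_drift_le (hi : Integrable g) (hg0 : ∀ x, 0 ≤ g x) (hmed : cdfOf g 0 = 1 / 2)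
    {l u s sBar t c b b₀ h H : ℝ} (hlu : l < u) (hs : |s| ≤ c) (hsB : |sBar| ≤ c) (ht : |t| ≤ c)
    (hb₀ : b₀ ≤ b) (hb0 : 0 ≤ b) (hb1 : b ≤ 1) (h0 : 0 < h)
    (hg : ∀ x, |x| ≤ max (2 * c) (max (c + l) (c - u)) → h ≤ g x ∧ g x ≤ H) :
    accelBeta g l l u u s sBar * b ^ 2 * (t - s) ^ 2 - 2 * b * innovationMean g l u s t * (t - s) ≤
      -(b₀ * h / 2) * (t - s) ^ 2 + 32 * H ^ 2 / h * (t - sBar) ^ 2 := by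
  have hH : 0 ≤ H := by
    have := hg 0 (by rw [abs_zero]; exact le_max_of_le_left (by linarith [abs_nonneg s]))
    linarith
  have hb := accelBeta_bounds hi hg0 hmed hlu hs hsB h0.le hg
  have e := accelBeta_mul_sub hmed hlu s sBar
  have hlip := abs_innovationMean_sub_le hi hg0 hs ht hsB hH fun x hx => (hg x hx).2
  set β := accelBeta g l l u u s sBar
  set x := t - s with hx
  set y := t - sBar with hy
  -- The linearization residual. As β(sBar - s) is the mean at sBar, it equals (ψ(t) - ψ(sBar)) -
  -- β(t - sBar), each part at most 2H|t - sBar|.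
  set η := innovationMean g l u s t - β * x with hη
  have hη' : |η| ≤ 4 * H * |y| := by
    have e1 : η = (innovationMean g l u s t - innovationMean g l u s sBar) - β * y := by
      rw [hη, ← e, hx, hy]; ring
    rw [e1]
    refine (abs_sub _ _).trans ?_
    rw [abs_mul, abs_of_nonneg (h0.le.trans hb.1)]
    nlinarith [mul_le_mul_of_nonneg_right hb.2 (abs_nonneg y)]
  have e2 : innovationMean g l u s t = β * x + η := by rw [hη]; ring
  rw [e2]
  have hx2 := sq_nonneg x
  have hβx : 0 ≤ β * x ^ 2 := mul_nonneg (h0.le.trans hb.1) hx2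
  have h2 : b ^ 2 * (β * x ^ 2) ≤ b * (β * x ^ 2) :=
    mul_le_mul_of_nonneg_right (by nlinarith) hβx
  have h3 : b * (h * x ^ 2) ≤ b * (β * x ^ 2) :=
    mul_le_mul_of_nonneg_left (mul_le_mul_of_nonneg_right hb.1 hx2) hb0
  -- Young's inequality for 8H|x||y|, spending half of the contraction h x².
  have h4 : -(2 * η * x) ≤ h / 2 * x ^ 2 + 32 * H ^ 2 / h * y ^ 2 := by
    have h5 : -(η * x) ≤ 4 * H * |y| * |x| := by
      refine (neg_le_abs _).trans ?_
      rw [abs_mul]; gcongr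
    have h6 : 0 ≤ (h * |x| - 8 * H * |y|) ^ 2 / (2 * h) := by positivity
    have h7 : (h * |x| - 8 * H * |y|) ^ 2 / (2 * h) =
        h / 2 * x ^ 2 + 32 * H ^ 2 / h * y ^ 2 - 2 * (4 * H * |y| * |x|) := by
      rw [← sq_abs x, ← sq_abs y]; field_simp; ring
    linarith
  have h5 := mul_le_mul_of_nonneg_left h4 hb0
  have h6 : b₀ * (h / 2 * x ^ 2) ≤ b * (h / 2 * x ^ 2) :=
    mul_le_mul_of_nonneg_right hb₀ (by positivity)
  have h7 : b * (32 * H ^ 2 / h * y ^ 2) ≤ 32 * H ^ 2 / h * y ^ 2 :=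
    mul_le_of_le_one_left (by positivity) hb1
  nlinarith

theorem abs_sign_le_one (x : ℝ) : |Real.sign x| ≤ 1 := by
  rcases Real.sign_apply_eq x with h | h | h <;> simp [h]

theorem abs_signInnovation_le (hi : Integrable g) (hg0 : ∀ x, 0 ≤ g x) (hg1 : ∫ x, g x = 1)
    (L l u U y s : ℝ) : |signInnovation g L l u U y s| ≤ 3 := by
  have h1 := abs_le.1 (abs_sign_le_one (y - saturate L l u U s))
  have h2 := cdfOf_nonneg hg0 (u - s)
  have h3 := cdfOf_le_one hi hg0 hg1 (u - s)
  have h4 := cdfOf_nonneg hg0 (l - s)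
  have h5 := cdfOf_le_one hi hg0 hg1 (l - s)
  unfold signInnovation
  split_ifs <;> rw [abs_le] <;> constructor <;> linarith

end Drift

/-! ### Summing the energy inequality. -/

section Accumulation

variable {d : ℕ} {D : Set (Fin d → ℝ)} {θ : Fin d → ℝ} {m β b v : ℕ → ℝ}
  {φ ϑ : ℕ → Fin d → ℝ} {P : ℕ → Matrix (Fin d) (Fin d) ℝ}

theorem posDef_of_isRecursiveStep (hP : (P 0).PosDef) (hm : ∀ k, 0 < m k) (hβ : ∀ k, 0 ≤ β k)
    (hstep : ∀ k, IsRecursiveStep D (m k) (β k) (b k) (v k) (φ k) (ϑ k) (P k) (ϑ (k + 1))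
      (P (k + 1))) (k : ℕ) : (P k).PosDef := by
  induction k with
  | zero => exact hP
  | succ k ih => exact ((hstep k).inv_eq ih (hm k) (hβ k)).1

/-- The information matrix has logarithmically growing log-determinant. -/
theorem exists_log_det_inv_le (hP : (P 0).PosDef) (hm : ∀ k, 0 < m k) (hβ : ∀ k, 0 ≤ β k)
    (hstep : ∀ k, IsRecursiveStep D (m k) (β k) (b k) (v k) (φ k) (ϑ k) (P k) (ϑ (k + 1))
      (P (k + 1))) {Γ B : ℝ} (hΓ : ∀ k, β k * b k ^ 2 / m k ≤ Γ) (hφ : ∀ k i, |φ k i| ≤ B) :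
    ∃ K : ℝ, ∀ n : ℕ, Real.log (P n)⁻¹.det ≤ K * (1 + Real.log (n + 1)) := by
  have hpos := posDef_of_isRecursiveStep hP hm hβ hstep
  have hΓ0 : 0 ≤ Γ := (div_nonneg (mul_nonneg (hβ 0) (sq_nonneg (b 0))) (hm 0).le).trans (hΓ 0)
  set K₀ : ℝ := ∑ i, ∑ j, |(P 0)⁻¹ i j| with hK₀
  have hK₀0 : 0 ≤ K₀ := Finset.sum_nonneg fun _ _ => Finset.sum_nonneg fun _ _ => abs_nonneg _
  -- Each update adds a bounded rank-one matrix, so entries grow linearly and the Leibniz formula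
  -- bounds the determinant by d! (K₁(n + 1))^d.
  have hent : ∀ n i j, |(P n)⁻¹ i j| ≤ K₀ + n * (Γ * B ^ 2) := by
    intro n
    induction n with
    | zero =>
      intro i j
      simp only [Nat.cast_zero, zero_mul, add_zero]
      exact (Finset.single_le_sum (f := fun j => |(P 0)⁻¹ i j|) (fun _ _ => abs_nonneg _)
        (Finset.mem_univ j)).trans (Finset.single_le_sum (f := fun i => ∑ j, |(P 0)⁻¹ i j|)
          (fun _ _ => Finset.sum_nonneg fun _ _ => abs_nonneg _) (Finset.mem_univ i))
    | succ n ih =>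
      intro i j
      have hγ0 : 0 ≤ β n * b n ^ 2 / m n :=
        div_nonneg (mul_nonneg (hβ n) (sq_nonneg _)) (hm n).le
      rw [((hstep n).inv_eq (hpos n) (hm n) (hβ n)).2.1]
      simp only [Matrix.add_apply, Matrix.smul_apply, vecMulVec_apply, smul_eq_mul]
      refine (abs_add_le _ _).trans ?_
      rw [abs_mul, abs_mul, abs_of_nonneg hγ0]
      have h1 : |φ n i| * |φ n j| ≤ B ^ 2 := by
        rw [sq]
        exact mul_le_mul (hφ n i) (hφ n j) (abs_nonneg _) ((abs_nonneg _).trans (hφ n i))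
      have h2 := mul_le_mul (hΓ n) h1 (by positivity) hΓ0
      push_cast
      linarith [ih i j]
  set K₁ : ℝ := K₀ + Γ * B ^ 2 + 1 with hK₁
  have hK₁1 : 1 ≤ K₁ := by
    have : 0 ≤ Γ * B ^ 2 := by positivity
    linarith
  refine ⟨Real.log (d.factorial : ℝ) + d * Real.log K₁ + d, fun n => ?_⟩
  have hn : (1 : ℝ) ≤ (n : ℝ) + 1 := by linarith [n.cast_nonneg (α := ℝ)]
  have hdet : (P n)⁻¹.det ≤ (d.factorial : ℝ) * (K₁ * ((n : ℝ) + 1)) ^ d := by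
    have hle := Matrix.det_le (A := (P n)⁻¹) (abv := AbsoluteValue.abs)
      (x := K₁ * ((n : ℝ) + 1)) fun i j => by
        refine (hent n i j).trans ?_
        have h1 : 0 ≤ Γ * B ^ 2 := by positivity
        have h2 : 0 ≤ K₀ * n := by positivity
        rw [hK₁]; nlinarith [n.cast_nonneg (α := ℝ)]
    simp only [Fintype.card_fin, nsmul_eq_mul] at hle
    exact (le_abs_self _).trans hle
  have hfac : (0 : ℝ) < d.factorial := by exact_mod_cast d.factorial_pos
  have h1 := Real.log_le_log (hpos n).inv.det_pos hdet
  rw [Real.log_mul hfac.ne' (by positivity), Real.log_pow,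
    Real.log_mul (by positivity) (by positivity)] at h1
  have hl := Real.log_nonneg hn
  have hl1 := Real.log_nonneg hK₁1
  have hl2 : 0 ≤ Real.log (d.factorial : ℝ) :=
    Real.log_nonneg (by exact_mod_cast d.factorial_pos)
  have hd0 : (0 : ℝ) ≤ d := d.cast_nonneg
  nlinarith [mul_nonneg hl2 hl, mul_nonneg (mul_nonneg hd0 hl1) hl]

/-- Accumulated squared prediction errors grow at most logarithmically, provided that the mean
innovation `ψ` contracts up to logarithmically growing errors and the noise `w` of the innovation
has self-normalized transforms. -/
theorem exists_sum_sq_le_log (hP : (P 0).PosDef) (hD : Convex ℝ D) (hθ : θ ∈ D)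
    (hβ : ∀ k, 0 ≤ β k)
    (hstep : ∀ k, IsRecursiveStep D (m k) (β k) (b k) (v k) (φ k) (ϑ k) (P k) (ϑ (k + 1))
      (P (k + 1)))
    {δ Bm h H Bφ c C' Be : ℝ} (hδ : 0 < δ) (hm : ∀ k, δ ≤ m k ∧ m k ≤ Bm) (hh : 0 < h)
    (hβb : ∀ k, h ≤ β k ∧ β k ≤ H) (hb : ∀ k, 0 ≤ b k ∧ b k ≤ 1) (hφ : ∀ k i, |φ k i| ≤ Bφ)
    (hv : ∀ k, |v k| ≤ 3) {ψ w e : ℕ → ℝ} (hvw : ∀ k, v k = ψ k + w k) (hc : 0 < c) (hC' : 0 ≤ C')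
    (he : ∀ n : ℕ, ∑ k ∈ Finset.range n, e k ≤ Be * (1 + Real.log (n + 1)))
    (he0 : ∀ k, 0 ≤ e k)
    (hdrift : ∀ k, β k * b k ^ 2 * (φ k ⬝ᵥ θ - φ k ⬝ᵥ ϑ k) ^ 2 -
      2 * b k * ψ k * (φ k ⬝ᵥ θ - φ k ⬝ᵥ ϑ k) ≤
        -c * (φ k ⬝ᵥ θ - φ k ⬝ᵥ ϑ k) ^ 2 + C' * e k)
    (hw : ∀ τ : ℝ, 0 < τ → ∃ B : ℝ, ∀ n : ℕ,
      ∑ k ∈ Finset.range n, -2 * (b k / m k) * (φ k ⬝ᵥ θ - φ k ⬝ᵥ ϑ k) * w k ≤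
        τ * ∑ k ∈ Finset.range n, (-2 * (b k / m k) * (φ k ⬝ᵥ θ - φ k ⬝ᵥ ϑ k)) ^ 2 +
          B * (1 + Real.log (n + 1))) :
    ∃ B : ℝ, ∀ n : ℕ, ∑ k ∈ Finset.range n, (φ k ⬝ᵥ θ - φ k ⬝ᵥ ϑ k) ^ 2 ≤
      B * (1 + Real.log (n + 1)) := by
  have hm0 : ∀ k, 0 < m k := fun k => hδ.trans_le (hm k).1
  have hpos := posDef_of_isRecursiveStep hP hm0 hβ hstep
  have hBm : 0 < Bm := (hm0 0).trans_le (hm 0).2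
  have hH : 0 ≤ H := (hβ 0).trans (hβb 0).2
  have hΓ : ∀ k, β k * b k ^ 2 / m k ≤ H / δ := by
    intro k
    have h1 : β k * b k ^ 2 ≤ H := by
      have : b k ^ 2 ≤ 1 := pow_le_one₀ (hb k).1 (hb k).2
      exact (mul_le_of_le_one_right (hβ k) this).trans (hβb k).2
    exact div_le_div₀ hH h1 hδ (hm k).1
  obtain ⟨Kd, hKd⟩ := exists_log_det_inv_le hP hm0 hβ hstep hΓ hφ
  -- Chosen so that 4τ/δ² = c/(2Bm): the martingale's quadratic variation consumes half of the
  -- drift.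
  set τ : ℝ := c * δ ^ 2 / (8 * Bm) with hτ
  obtain ⟨Bw, hBw⟩ := hw τ (by positivity)
  set s : ℕ → ℝ := fun k => φ k ⬝ᵥ θ - φ k ⬝ᵥ ϑ k with hs
  set V : ℕ → ℝ := fun k => (θ - ϑ k) ⬝ᵥ ((P k)⁻¹ *ᵥ (θ - ϑ k)) with hV
  have hV0 : ∀ k, 0 ≤ V k := fun k => (hpos k).inv.posSemidef.dotProduct_mulVec_self_nonneg _
  set Λ : ℕ → ℝ := fun k => Real.log (P k)⁻¹.det with hΛ
  -- It bounds v²/(mβ), by |v| ≤ 3, m ≥ δ and β ≥ h; this is the ratio of (bv/m)² to βb²/m.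
  set G : ℝ := 9 / (δ * h) with hG
  have hG0 : 0 < G := by positivity
  have hone : ∀ k, V (k + 1) ≤ V k - c / Bm * s k ^ 2 + C' / δ * e k +
      -2 * (b k / m k) * s k * w k + G * (Λ (k + 1) - Λ k) := by
    intro k
    have h1 := (hstep k).energy_le (hpos k) (hm0 k) (hβ k) hD hθ
    have h2 := ((hstep k).inv_eq (hpos k) (hm0 k) (hβ k)).2.2.2
    set ρ := φ k ⬝ᵥ (P (k + 1) *ᵥ φ k) with hρ
    have hρ0 : 0 ≤ ρ := (hpos (k + 1)).posSemidef.dotProduct_mulVec_self_nonneg _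
    have hdet0 := (hpos k).inv.det_pos
    have hdet1 := (hpos (k + 1)).inv.det_pos
    -- One minus the determinant ratio is at most minus its logarithm, which telescopes.
    have h3 : β k * b k ^ 2 / m k * ρ ≤ Λ (k + 1) - Λ k := by
      have := Real.log_le_sub_one_of_pos (div_pos hdet0 hdet1)
      rw [Real.log_div hdet0.ne' hdet1.ne'] at this
      rw [h2]
      linarith
    have h4 : (b k * v k / m k) ^ 2 * ρ ≤ G * (Λ (k + 1) - Λ k) := by
      refine le_trans ?_ (mul_le_mul_of_nonneg_left h3 hG0.le)
      rw [← mul_assoc]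
      refine mul_le_mul_of_nonneg_right ?_ hρ0
      have hv9 : v k ^ 2 ≤ 9 := by nlinarith [abs_le.1 (hv k)]
      have h5 : v k ^ 2 / (m k * β k) ≤ G := by
        refine div_le_div₀ (by norm_num) hv9 (by positivity) ?_
        exact mul_le_mul (hm k).1 (hβb k).1 hh.le (hm0 k).le
      have hβ0 : 0 < β k := hh.trans_le (hβb k).1
      have h6 : (b k * v k / m k) ^ 2 = v k ^ 2 / (m k * β k) * (β k * b k ^ 2 / m k) := by
        have := hm0 k
        field_simp
      rw [h6]
      exact mul_le_mul_of_nonneg_right h5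
        (div_nonneg (mul_nonneg (hβ k) (sq_nonneg _)) (hm0 k).le)
    have h5 : β k * b k ^ 2 / m k * s k ^ 2 - 2 * (b k * v k / m k) * s k =
        (β k * b k ^ 2 * s k ^ 2 - 2 * b k * ψ k * s k) / m k - 2 * (b k / m k) * s k * w k := by
      rw [hvw k]; ring
    have h6 : (β k * b k ^ 2 * s k ^ 2 - 2 * b k * ψ k * s k) / m k ≤
        -(c / Bm * s k ^ 2) + C' / δ * e k := by
      have h7 : (β k * b k ^ 2 * s k ^ 2 - 2 * b k * ψ k * s k) / m k ≤
          (-c * s k ^ 2 + C' * e k) / m k := div_le_div_of_nonneg_right (hdrift k) (hm0 k).le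
      have h8 : c * s k ^ 2 / Bm ≤ c * s k ^ 2 / m k :=
        div_le_div_of_nonneg_left (by positivity) (hm0 k) (hm k).2
      have h9 : C' * e k / m k ≤ C' * e k / δ :=
        div_le_div_of_nonneg_left (mul_nonneg hC' (he0 k)) hδ (hm k).1
      have e1 : (-c * s k ^ 2 + C' * e k) / m k = -(c * s k ^ 2 / m k) + C' * e k / m k := by ring
      have e2 : c / Bm * s k ^ 2 = c * s k ^ 2 / Bm := by ring
      have e3 : C' / δ * e k = C' * e k / δ := by ring
      rw [e2, e3]; linarith
    linarith
  have hsum : ∀ n : ℕ, V n ≤ V 0 - c / Bm * ∑ k ∈ Finset.range n, s k ^ 2 +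
      C' / δ * ∑ k ∈ Finset.range n, e k + ∑ k ∈ Finset.range n, -2 * (b k / m k) * s k * w k +
      G * (Λ n - Λ 0) := by
    intro n
    induction n with
    | zero => simp
    | succ n ih =>
      simp only [Finset.sum_range_succ]
      linarith [hone n]
  have hξ : ∀ n : ℕ, τ * ∑ k ∈ Finset.range n, (-2 * (b k / m k) * s k) ^ 2 ≤
      c / (2 * Bm) * ∑ k ∈ Finset.range n, s k ^ 2 := by
    intro n
    rw [Finset.mul_sum, Finset.mul_sum]
    refine Finset.sum_le_sum fun k _ => ?_
    have h1 : b k / m k ≤ 1 / δ := div_le_div₀ zero_le_one (hb k).2 hδ (hm k).1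
    have h2 : (b k / m k) ^ 2 ≤ (1 / δ) ^ 2 :=
      pow_le_pow_left₀ (div_nonneg (hb k).1 (hm0 k).le) h1 2
    calc τ * (-2 * (b k / m k) * s k) ^ 2 = 4 * τ * s k ^ 2 * (b k / m k) ^ 2 := by ring
      _ ≤ 4 * τ * s k ^ 2 * (1 / δ) ^ 2 := by gcongr
      _ = c / (2 * Bm) * s k ^ 2 := by rw [hτ]; field_simp; ring
  refine ⟨(2 * Bm / c) * (V 0 + C' / δ * Be + Bw + G * (Kd + |Λ 0|)), fun n => ?_⟩
  set ℓ : ℝ := 1 + Real.log (n + 1) with hℓ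
  have hℓ1 : 1 ≤ ℓ := by
    have := Real.log_nonneg (show (1 : ℝ) ≤ (n : ℝ) + 1 by linarith [n.cast_nonneg (α := ℝ)])
    linarith
  have hmain : c / (2 * Bm) * ∑ k ∈ Finset.range n, s k ^ 2 ≤
      (V 0 + C' / δ * Be + Bw + G * (Kd + |Λ 0|)) * ℓ := by
    have h1 := hsum n
    have h2 := hξ n
    have h3 := hBw n
    have h4 := mul_le_mul_of_nonneg_left (he n) (show 0 ≤ C' / δ by positivity)
    have h5 : G * (Λ n - Λ 0) ≤ G * ((Kd + |Λ 0|) * ℓ) := by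
      refine mul_le_mul_of_nonneg_left ?_ hG0.le
      have := hKd n
      have h6 : -Λ 0 ≤ |Λ 0| * ℓ :=
        (neg_le_abs _).trans (le_mul_of_one_le_right (abs_nonneg _) hℓ1)
      linarith
    have h6 : V 0 ≤ V 0 * ℓ := le_mul_of_one_le_right (hV0 0) hℓ1
    have h7 := hV0 n
    have e1 : c / Bm = 2 * (c / (2 * Bm)) := by field_simp
    rw [e1] at h1
    linarith
  have h8 := mul_le_mul_of_nonneg_left hmain (show 0 ≤ 2 * Bm / c by positivity)
  have e2 : 2 * Bm / c * (c / (2 * Bm) * ∑ k ∈ Finset.range n, s k ^ 2) =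
      ∑ k ∈ Finset.range n, s k ^ 2 := by field_simp
  rw [e2] at h8
  linarith

end Accumulation

/-! ### Measurability of gains, innovations and recursive steps. -/

section Measurability

variable {Ω : Type*} {m : MeasurableSpace Ω}

theorem measurable_saturate {L l u U x : Ω → ℝ} (hL : Measurable L) (hl : Measurable l)
    (hu : Measurable u) (hU : Measurable U) (hx : Measurable x) :
    Measurable fun ω => saturate (L ω) (l ω) (u ω) (U ω) (x ω) :=
  Measurable.ite (measurableSet_lt hx hl) hL (Measurable.ite (measurableSet_le hx hu) hx hU)

theorem measurable_real_sign {x : Ω → ℝ} (hx : Measurable x) :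
    Measurable fun ω => Real.sign (x ω) := by
  unfold Real.sign
  exact Measurable.ite (measurableSet_lt hx measurable_const) measurable_const
    (Measurable.ite (measurableSet_lt measurable_const hx) measurable_const measurable_const)

theorem measurable_dotProduct {d : ℕ} {x y : Ω → Fin d → ℝ} (hx : Measurable x)
    (hy : Measurable y) : Measurable fun ω => x ω ⬝ᵥ y ω :=
  Finset.measurable_fun_sum _ fun i _ =>
    ((measurable_pi_apply i).comp hx).mul ((measurable_pi_apply i).comp hy)

theorem measurable_mulVec {d : ℕ} {A : Ω → Matrix (Fin d) (Fin d) ℝ} {x : Ω → Fin d → ℝ}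
    (hA : ∀ i j, Measurable fun ω => A ω i j) (hx : Measurable x) :
    Measurable fun ω => A ω *ᵥ x ω :=
  measurable_pi_lambda _ fun i => measurable_dotProduct (x := fun ω => A ω i)
    (measurable_pi_lambda _ fun j => hA i j) hx

theorem measurable_matrix_mul {d : ℕ} {A B : Ω → Matrix (Fin d) (Fin d) ℝ}
    (hA : ∀ i j, Measurable fun ω => A ω i j) (hB : ∀ i j, Measurable fun ω => B ω i j)
    (i j : Fin d) : Measurable fun ω => (A ω * B ω) i j := by
  simp only [Matrix.mul_apply]
  exact Finset.measurable_fun_sum _ fun k _ => (hA i k).mul (hB k j)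

/-- One recursive step preserves measurability. -/
theorem measurable_of_isRecursiveStep {d : ℕ} {D : Set (Fin d → ℝ)} (hD : Convex ℝ D)
    (hDc : IsCompact D) {μ β b v : Ω → ℝ} {φ ϑ ϑ' : Ω → Fin d → ℝ}
    {P P' : Ω → Matrix (Fin d) (Fin d) ℝ} (hμ : Measurable μ) (hβ : Measurable β)
    (hb : Measurable b) (hv : Measurable v) (hφ : Measurable φ) (hϑ : Measurable ϑ)
    (hP : ∀ i j, Measurable fun ω => P ω i j) (hμ0 : ∀ ω, 0 < μ ω) (hβ0 : ∀ ω, 0 ≤ β ω)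
    (hpos : ∀ ω, (P ω).PosDef)
    (h : ∀ ω, IsRecursiveStep D (μ ω) (β ω) (b ω) (v ω) (φ ω) (ϑ ω) (P ω) (ϑ' ω) (P' ω)) :
    Measurable ϑ' ∧ ∀ i j, Measurable fun ω => P' ω i j := by
  have hPφ := measurable_mulVec hP hφ
  have ha : Measurable fun ω => stepSize (μ ω) (β ω) (b ω) (φ ω) (P ω) :=
    (hμ.add ((hβ.mul (hb.pow_const 2)).mul (measurable_dotProduct hφ hPφ))).const_div 1
  have hP' : ∀ i j, Measurable fun ω => P' ω i j := by
    intro i j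
    have e : (fun ω => P' ω i j) = fun ω => P ω i j -
        stepSize (μ ω) (β ω) (b ω) (φ ω) (P ω) * β ω * b ω ^ 2 *
          (P ω * vecMulVec (φ ω) (φ ω) * P ω) i j := by
      ext ω
      rw [(h ω).1]; simp
    rw [e]
    refine (hP i j).sub (((ha.mul hβ).mul (hb.pow_const 2)).mul ?_)
    exact measurable_matrix_mul (measurable_matrix_mul hP fun i j =>
      ((measurable_pi_apply i).comp hφ).mul ((measurable_pi_apply j).comp hφ)) hP i j
  refine ⟨?_, hP'⟩
  have hx : Measurable fun ω => ϑ ω +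
      (stepSize (μ ω) (β ω) (b ω) (φ ω) (P ω) * b ω * v ω) • (P ω *ᵥ φ ω) :=
    hϑ.add (((ha.mul hb).mul hv).smul hPφ)
  exact measurable_of_isWeightedProj hD hDc hx hP'
    (fun ω => ((h ω).inv_eq (hpos ω) (hμ0 ω) (hβ0 ω)).1) fun ω => (h ω).2

variable {Ω : Type*} {m : MeasurableSpace Ω} [mΩ : MeasurableSpace Ω] {Pr : Measure Ω}
  {X : Ω → ℝ} {g : Ω → ℝ → ℝ}

/-- Rescaling the random interval to [-1, 1] and using rational points, by continuity of the
density, turns the infimum into a countable one. A negative radius gives the default value 0. -/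
theorem IsMedianZeroCondDensity.measurable_prelimBeta (hg : IsMedianZeroCondDensity Pr m X g)
    {l u c : Ω → ℝ} (hl : Measurable[m] l) (hu : Measurable[m] u) (hc : Measurable[m] c) :
    Measurable[m] fun ω => prelimBeta (g ω) (l ω) (u ω) (c ω) := by
  set ρ : Ω → ℝ := fun ω => max (2 * c ω) (max (c ω + l ω) (c ω - u ω)) with hρ
  have hρm : Measurable[m] ρ :=
    Measurable.max (hc.const_mul 2) ((hc.add hl).max (hc.sub hu))
  refine measurable_of_Iio fun a => ?_
  have e : (fun ω => prelimBeta (g ω) (l ω) (u ω) (c ω)) ⁻¹' Iio a =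
      ({ω | ρ ω < 0} ∩ {_ω | 0 < a}) ∪
        ({ω | 0 ≤ ρ ω} ∩ ⋃ q : {q : ℚ // |(q : ℝ)| ≤ 1}, {ω | g ω (ρ ω * q) < a}) := by
    ext ω
    simp only [mem_preimage, mem_Iio, mem_union, mem_inter_iff, mem_ofPred_eq, mem_iUnion]
    rcases lt_or_ge (ρ ω) 0 with h | h
    · have : {x : ℝ | |x| ≤ ρ ω} = ∅ := by
        ext x; simp only [mem_ofPred_eq, mem_empty_iff_false, iff_false, not_le]
        exact h.trans_le (abs_nonneg x)
      have e2 : prelimBeta (g ω) (l ω) (u ω) (c ω) = 0 := by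
        unfold prelimBeta; rw [show {x : ℝ | |x| ≤ max (2 * c ω) (max (c ω + l ω) (c ω - u ω))} = ∅
          from this]; simp
      rw [e2]
      simp [h]
    · simp only [not_lt.2 h, false_and, h, true_and, false_or]
      have hne : (g ω '' {x : ℝ | |x| ≤ ρ ω}).Nonempty := ⟨g ω 0, 0, by simpa using h, rfl⟩
      have hbdd : BddBelow (g ω '' {x : ℝ | |x| ≤ ρ ω}) :=
        ⟨0, by rintro _ ⟨x, -, rfl⟩; exact hg.nonneg ω x⟩
      constructor
      · intro hlt
        obtain ⟨_, ⟨x, hx, rfl⟩, hxa⟩ := (csInf_lt_iff hbdd hne).1 hlt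
        have hx' : |x| ≤ ρ ω := hx
        rcases h.eq_or_lt with h0 | h0
        · have hx0 : x = 0 := by rw [← h0] at hx'; exact abs_nonpos_iff.1 hx'
          refine ⟨⟨0, by simp⟩, ?_⟩
          rw [hx0] at hxa
          simpa using hxa
        · have hopen : IsOpen {z : ℝ | g ω (ρ ω * z) < a} :=
            isOpen_lt ((hg.continuous ω).comp (continuous_const.mul continuous_id)) continuous_const
          -- The point may be an endpoint ±1, so it is first moved into the open interval, where
          -- rationals are dense.
          have hz : x / ρ ω ∈ closure (Ioo (-1 : ℝ) 1) := by
            rw [closure_Ioo (by norm_num)]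
            rw [abs_le] at hx'
            exact ⟨by rw [le_div_iff₀ h0]; linarith, by rw [div_le_iff₀ h0]; linarith⟩
          have hmem : x / ρ ω ∈ {z : ℝ | g ω (ρ ω * z) < a} := by
            simp only [mem_ofPred_eq]
            rwa [mul_div_cancel₀ _ h0.ne']
          have hne2 := mem_closure_iff.1 hz _ hopen hmem
          obtain ⟨q, hq⟩ := Rat.denseRange_cast.exists_mem_open (hopen.inter isOpen_Ioo) hne2
          exact ⟨⟨q, abs_le.2 ⟨hq.2.1.le, hq.2.2.le⟩⟩, hq.1⟩
      · rintro ⟨q, hq⟩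
        refine (csInf_le hbdd ⟨ρ ω * q, ?_, rfl⟩).trans_lt hq
        simp only [mem_ofPred_eq]
        rw [abs_mul, abs_of_nonneg h]
        exact mul_le_of_le_one_right h q.2
  rw [e]
  refine ((measurableSet_lt hρm measurable_const).inter (@MeasurableSet.const _ m _)).union
    ((measurableSet_le measurable_const hρm).inter (MeasurableSet.iUnion fun q => ?_))
  exact measurableSet_lt (hg.measurable_eval (hρm.mul_const _)) measurable_const

theorem IsMedianZeroCondDensity.measurable_accelBeta (hg : IsMedianZeroCondDensity Pr m X g)
    {L l u U s sBar : Ω → ℝ} (hL : Measurable[m] L) (hl : Measurable[m] l) (hu : Measurable[m] u)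
    (hU : Measurable[m] U) (hs : Measurable[m] s) (hsB : Measurable[m] sBar) :
    Measurable[m] fun ω => accelBeta (g ω) (L ω) (l ω) (u ω) (U ω) (s ω) (sBar ω) := by
  have hS := measurable_saturate hL hl hu hU hs
  have hd : MeasurableSet[m] {ω | sBar ω - s ω ≠ 0} :=
    (measurableSet_eq_fun (hsB.sub hs) measurable_const).compl
  have key : ∀ a : Ω → ℝ, Measurable[m] a → Measurable[m] fun ω =>
      if sBar ω - s ω ≠ 0 then
        (cdfOf (g ω) (a ω - s ω) - cdfOf (g ω) (a ω - sBar ω)) / (sBar ω - s ω)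
      else g ω (a ω - s ω) := fun a ha =>
    Measurable.ite hd (((hg.measurable_cdfOf (ha.sub hs)).sub
      (hg.measurable_cdfOf (ha.sub hsB))).div (hsB.sub hs)) (hg.measurable_eval (ha.sub hs))
  refine Measurable.ite (measurableSet_eq_fun hS hL) (key l hl)
    (Measurable.ite (measurableSet_eq_fun hS hU) (key u hu) (Measurable.ite hd ?_ ?_))
  · exact (((hg.measurable_cdfOf (hs.sub hsB)).const_mul 2).const_sub 1).div (hsB.sub hs)
  · exact (hg.measurable 0).const_mul 2

theorem IsMedianZeroCondDensity.measurable_signInnovation {Ω : Type*}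
    {m m' : MeasurableSpace Ω} [mΩ : MeasurableSpace Ω] {Pr : Measure Ω}
    {X : Ω → ℝ} {g : Ω → ℝ → ℝ} (hg : IsMedianZeroCondDensity Pr m X g) (hmm : m ≤ m')
    {L l u U y s : Ω → ℝ} (hL : Measurable[m] L) (hl : Measurable[m] l) (hu : Measurable[m] u)
    (hU : Measurable[m] U) (hs : Measurable[m] s) (hy : Measurable[m'] y) :
    Measurable[m'] fun ω => signInnovation (g ω) (L ω) (l ω) (u ω) (U ω) (y ω) (s ω) := by
  have hS := measurable_saturate hL hl hu hU hs
  have h1 : Measurable[m] fun ω => if saturate (L ω) (l ω) (u ω) (U ω) (s ω) = U ω then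
      cdfOf (g ω) (u ω - s ω) else 0 :=
    Measurable.ite (measurableSet_eq_fun hS hU) (hg.measurable_cdfOf (hu.sub hs)) measurable_const
  have h2 : Measurable[m] fun ω => if saturate (L ω) (l ω) (u ω) (U ω) (s ω) = L ω then
      1 - cdfOf (g ω) (l ω - s ω) else 0 :=
    Measurable.ite (measurableSet_eq_fun hS hL) ((hg.measurable_cdfOf (hl.sub hs)).const_sub 1)
      measurable_const
  exact ((measurable_real_sign (hy.sub (hS.mono hmm le_rfl))).add (h1.mono hmm le_rfl)).sub
    (h2.mono hmm le_rfl)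

end Measurability

/-! ### Absolute noise and the averaged error. -/

section PredictionError

open scoped ENNReal

/-- Predictable factors can be pulled out of the conditional Lebesgue expectation. -/
theorem condLExp_mul_of_measurable {Ω : Type*} {m : MeasurableSpace Ω} [mΩ : MeasurableSpace Ω]
    {Pr : Measure Ω} [IsProbabilityMeasure Pr] (hm : m ≤ mΩ) {Z Y : Ω → ℝ≥0∞}
    (hZ : Measurable[m] Z) (hY : Measurable Y) :
    condLExp m Pr (fun ω => Z ω * Y ω) =ᵐ[Pr] fun ω => Z ω * condLExp m Pr Y ω := by
  have hE := measurable_condLExp m Pr Y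
  refine (ae_eq_condLExp hm Pr _ (hZ.mul hE) fun A hA => ?_).symm
  have hI : Measurable[m] (A.indicator Z) := hZ.indicator hA
  have e : ∀ T : Ω → ℝ≥0∞, ∫⁻ ω in A, Z ω * T ω ∂Pr = ∫⁻ ω, A.indicator Z ω * T ω ∂Pr := by
    intro T
    rw [← lintegral_indicator (hm _ hA)]
    refine lintegral_congr fun ω => ?_
    by_cases hω : ω ∈ A <;> simp [hω]
  have hE' : Measurable (condLExp m Pr Y) := hE.mono hm le_rfl
  change ∫⁻ ω in A, Z ω * condLExp m Pr Y ω ∂Pr = _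
  rw [e, e]
  refine le_antisymm ?_ ?_
  · exact lintegral_mul_le_of_setLIntegral_le hm hE' hY hI fun B hB =>
      (setLIntegral_condLExp hm Pr Y hB).le
  · exact lintegral_mul_le_of_setLIntegral_le hm hY hE' hI fun B hB =>
      (setLIntegral_condLExp hm Pr Y hB).ge

variable {Ω : Type*} [mΩ : MeasurableSpace Ω] {Pr : Measure Ω} [IsProbabilityMeasure Pr]
  {F : Filtration ℕ mΩ}

/-- From x² ≤ 1 + |x|^r. -/
theorem ae_iSup_condMoment_two_lt_top {ε : ℕ → Ω → ℝ} {r : ℝ}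
    (hr : 2 ≤ r) (h : ∀ᵐ ω ∂Pr, (⨆ k, condMoment Pr F ε r k ω) < ⊤) :
    ∀ᵐ ω ∂Pr, (⨆ k, condLExp (F k) Pr (fun ω' => ENNReal.ofReal (ε (k + 1) ω' ^ 2)) ω) < ⊤ := by
  have hk : ∀ k, ∀ᵐ ω ∂Pr, condLExp (F k) Pr (fun ω' => ENNReal.ofReal (ε (k + 1) ω' ^ 2)) ω ≤
      1 + condMoment Pr F ε r k ω := by
    intro k
    have h1 : condLExp (F k) Pr (fun ω' => ENNReal.ofReal (ε (k + 1) ω' ^ 2)) ≤ᵐ[Pr]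
        condLExp (F k) Pr ((fun _ => 1) + fun ω' => ENNReal.ofReal (|ε (k + 1) ω'| ^ r)) := by
      refine condLExp_mono (Eventually.of_forall fun ω => ?_)
      simp only [Pi.add_apply]
      rw [← ENNReal.ofReal_one, ← ENNReal.ofReal_add zero_le_one (by positivity)]
      refine ENNReal.ofReal_le_ofReal ?_
      rw [← sq_abs]
      rcases le_total |ε (k + 1) ω| 1 with h1 | h1
      · have h2 : |ε (k + 1) ω| ^ 2 ≤ 1 := pow_le_one₀ (abs_nonneg _) h1
        have h3 : 0 ≤ |ε (k + 1) ω| ^ r := by positivity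
        linarith
      · have h2 := Real.rpow_le_rpow_of_exponent_le h1 hr
        rw [Real.rpow_two] at h2
        linarith
    have h2 := condLExp_add_left (P := Pr) (mΩ := F k) (X := fun _ => 1)
      (fun ω' => ENNReal.ofReal (|ε (k + 1) ω'| ^ r)) measurable_const.aemeasurable
    filter_upwards [h1, h2] with ω g1 g2
    rw [g2, Pi.add_apply, condLExp_const (F.le k)] at g1
    exact g1
  filter_upwards [h, ae_all_iff.2 hk] with ω hω hall
  refine (iSup_le fun k => (hall k).trans
    (add_le_add le_rfl (le_iSup (fun k => condMoment Pr F ε r k ω) k))).trans_lt ?_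
  exact ENNReal.add_lt_top.2 ⟨ENNReal.one_lt_top, hω⟩

/-- The weighted absolute noise is, up to `O(n ^ (3 / 4))`, bounded by the weighted conditional
standard deviations. -/
theorem ae_sum_weighted_noise_le {ε b : ℕ → Ω → ℝ} (hε : ∀ k, Measurable[F k] (ε k))
    (hb : ∀ k, Measurable[F k] (b k)) (hb1 : ∀ᵐ ω ∂Pr, ∀ k, |b k ω| ≤ 1) {r : ℝ} (hr : 2 ≤ r)
    (h : ∀ᵐ ω ∂Pr, (⨆ k, condMoment Pr F ε r k ω) < ⊤) :
    ∀ᵐ ω ∂Pr, ∃ B : ℝ, ∀ n : ℕ, ∑ k ∈ Finset.range n, (|b k ω| * |ε (k + 1) ω| -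
      |b k ω| * Real.sqrt (noiseVariance Pr F ε k ω)) ≤ B * ((n : ℝ) + 1) ^ (3 / 4 : ℝ) := by
  have hεm : ∀ k, Measurable (ε k) := fun k => (hε k).mono (F.le k) le_rfl
  have h2 := ae_iSup_condMoment_two_lt_top hr h
  have hsum := ae_sum_le_rpow_of_condLExp_bdd F (X := fun k ω => ε (k + 1) ω ^ 2)
    (fun k => (hεm (k + 1)).pow_const 2) (fun k ω => sq_nonneg _) h2
    (show (1 : ℝ) < 5 / 4 by norm_num)
  have hvar : ∀ k, Measurable[F k] (noiseVariance Pr F ε k) := fun k =>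
    (measurable_condLExp (F k) Pr _).ennreal_toReal
  -- The weights are nonnegative only almost surely, while nonnegativity is required at every sample
  -- point; hence |b|.
  refine ae_sum_sub_condMean_le F (X := fun k ω => |b k ω| * |ε (k + 1) ω|)
    (s := fun k ω => |b k ω| * Real.sqrt (noiseVariance Pr F ε k ω)) (fun k => ?_)
    (fun k ω => by positivity) (fun k => ?_) (fun k ω => by positivity) (fun k => ?_) ?_
  · exact (continuous_abs.measurable.comp ((hb k).mono (F.mono (Nat.le_succ k)) le_rfl)).mul
      (continuous_abs.measurable.comp (hε (k + 1)))
  · exact (continuous_abs.measurable.comp (hb k)).mul (hvar k).sqrt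
  · have hfin : ∀ᵐ ω ∂Pr,
        condLExp (F k) Pr (fun ω => ENNReal.ofReal (ε (k + 1) ω ^ 2)) ω < ∞ := by
      filter_upwards [h2] with ω hω
      exact (le_iSup (fun k => condLExp (F k) Pr
        (fun ω' => ENNReal.ofReal (ε (k + 1) ω' ^ 2)) ω) k).trans_lt hω
    have habs : Measurable fun ω => |ε (k + 1) ω| := continuous_abs.measurable.comp (hεm (k + 1))
    have e : (fun ω => ENNReal.ofReal (|b k ω| * |ε (k + 1) ω|)) =
        fun ω => ENNReal.ofReal |b k ω| * ENNReal.ofReal |ε (k + 1) ω| := by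
      ext ω; rw [ENNReal.ofReal_mul (abs_nonneg _)]
    rw [e]
    filter_upwards [condLExp_ofReal_abs_le_sqrt (F.le k) (hεm (k + 1)) hfin,
      condLExp_mul_of_measurable (Pr := Pr) (F.le k)
        (continuous_abs.measurable.comp (hb k)).ennreal_ofReal habs.ennreal_ofReal] with ω g1 g2
    have g3 : condLExp (F k) Pr (fun ω => ENNReal.ofReal |b k ω| *
        ENNReal.ofReal |ε (k + 1) ω|) ω = ENNReal.ofReal |b k ω| *
          condLExp (F k) Pr (fun ω => ENNReal.ofReal |ε (k + 1) ω|) ω := g2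
    rw [g3, ENNReal.ofReal_mul (abs_nonneg _)]
    exact mul_le_mul' le_rfl g1
  · filter_upwards [hsum, hb1] with ω ⟨B, hB⟩ hω
    refine ⟨B, fun n => (Finset.sum_le_sum fun k _ => ?_).trans (hB n)⟩
    rw [mul_pow, sq_abs, sq_abs, ← sq_abs (b k ω)]
    exact mul_le_of_le_one_left (sq_nonneg _) (pow_le_one₀ (abs_nonneg _) (hω k))

/-- Eventually log log n ≥ 1, so the rate n^{-1/4} is the smaller one. -/
theorem isBigO_inv_rpow_loglog (K : ℝ) :
    (fun n : ℕ => K * (1 / (n : ℝ)) ^ (1 / 4 : ℝ)) =O[atTop]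
      (fun n : ℕ => (Real.log (Real.log n) / n) ^ (1 / 4 : ℝ)) := by
  refine Asymptotics.IsBigO.const_mul_left ?_ K
  refine Asymptotics.IsBigO.of_bound 1 ?_
  have h1 : ∀ᶠ n : ℕ in atTop, 1 ≤ Real.log (Real.log n) :=
    (Real.tendsto_log_atTop.comp (Real.tendsto_log_atTop.comp
      tendsto_natCast_atTop_atTop)).eventually_ge_atTop 1
  filter_upwards [h1] with n hn
  rw [Real.norm_of_nonneg (by positivity), Real.norm_of_nonneg (by positivity), one_mul]
  gcongr

/-- Combination of the bounds on the prediction part and on the noise part. -/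
theorem avg_abs_le_of_sum_bounds {b x σ2 E e : ℕ → ℝ} {B₁ B₂ : ℝ} (hb : ∀ k, 0 ≤ b k ∧ b k ≤ 1)
    (hσ : ∀ k, 0 ≤ σ2 k) (hE : ∀ k, E k ≤ |x k| + |e k|)
    (hx : ∀ n : ℕ, ∑ k ∈ Finset.range n, x k ^ 2 ≤ B₁ * (1 + Real.log (n + 1)))
    (he : ∀ n : ℕ, ∑ k ∈ Finset.range n, (b k * |e k| - b k * Real.sqrt (σ2 k)) ≤
      B₂ * ((n : ℝ) + 1) ^ (3 / 4 : ℝ)) :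
    ∃ K : ℝ, ∀ n : ℕ, 1 ≤ n → (∑ k ∈ Finset.range n, b k * E k) / n ≤
      Real.sqrt ((∑ k ∈ Finset.range n, b k ^ 2 * σ2 k) / n) + K * (1 / (n : ℝ)) ^ (1 / 4 : ℝ) := by
  -- The 2 comes from (n + 1)^{3/4} ≤ 2 n^{3/4}, the 5 from 1 + log N ≤ 5 N^{1/2}.
  refine ⟨2 * (Real.sqrt (5 * |B₁|) + |B₂|), fun n hn => ?_⟩
  have hn1 : (1 : ℝ) ≤ n := by exact_mod_cast hn
  have hn0 : (0 : ℝ) < n := by linarith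
  set N : ℝ := (n : ℝ) + 1 with hN
  have hN1 : 1 ≤ N := by linarith
  have hN0 : 0 < N := by linarith
  have hcs : ∀ z : ℕ → ℝ, ∑ k ∈ Finset.range n, z k ≤
      Real.sqrt (n * ∑ k ∈ Finset.range n, z k ^ 2) := fun z => by
    refine Real.le_sqrt_of_sq_le ?_
    simpa using sq_sum_le_card_mul_sum_sq (s := Finset.range n) (f := z)
  have hlog : 1 + Real.log N ≤ 5 * N ^ (1 / 2 : ℝ) := by
    have h1 := Real.log_le_rpow_div hN0.le (show (0 : ℝ) < 1 / 2 by norm_num)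
    have h2 : 1 ≤ N ^ (1 / 2 : ℝ) := Real.one_le_rpow hN1 (by norm_num)
    linarith
  have hpred : ∑ k ∈ Finset.range n, |x k| ≤ Real.sqrt (5 * |B₁|) * N ^ (3 / 4 : ℝ) := by
    refine (hcs fun k => |x k|).trans ?_
    have e1 : N ^ (3 / 4 : ℝ) = Real.sqrt (N ^ (3 / 2 : ℝ)) := by
      rw [Real.sqrt_eq_rpow, ← Real.rpow_mul hN0.le]; norm_num
    rw [e1, ← Real.sqrt_mul (by positivity)]
    refine Real.sqrt_le_sqrt ?_
    simp only [sq_abs]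
    have e2 : N ^ (3 / 2 : ℝ) = N * N ^ (1 / 2 : ℝ) := by
      nth_rewrite 2 [← Real.rpow_one N]
      rw [← Real.rpow_add hN0]; norm_num
    have h1 : ∑ k ∈ Finset.range n, x k ^ 2 ≤ |B₁| * (5 * N ^ (1 / 2 : ℝ)) := by
      have h0 : 0 ≤ 1 + Real.log N := by linarith [Real.log_nonneg hN1]
      calc _ ≤ B₁ * (1 + Real.log N) := hx n
        _ ≤ |B₁| * (1 + Real.log N) := mul_le_mul_of_nonneg_right (le_abs_self _) h0
        _ ≤ _ := mul_le_mul_of_nonneg_left hlog (abs_nonneg _)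
    calc (n : ℝ) * ∑ k ∈ Finset.range n, x k ^ 2
        ≤ N * (|B₁| * (5 * N ^ (1 / 2 : ℝ))) :=
          mul_le_mul (by linarith) h1 (Finset.sum_nonneg fun _ _ => sq_nonneg _) hN0.le
      _ = 5 * |B₁| * N ^ (3 / 2 : ℝ) := by rw [e2]; ring
  have hsig : ∑ k ∈ Finset.range n, b k * Real.sqrt (σ2 k) ≤
      Real.sqrt (n * ∑ k ∈ Finset.range n, b k ^ 2 * σ2 k) := by
    refine (hcs fun k => b k * Real.sqrt (σ2 k)).trans (le_of_eq ?_)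
    congr 2
    exact Finset.sum_congr rfl fun k _ => by rw [mul_pow, Real.sq_sqrt (hσ k)]
  have hnoise := he n
  rw [Finset.sum_sub_distrib] at hnoise
  have htotal : ∑ k ∈ Finset.range n, b k * E k ≤
      Real.sqrt (n * ∑ k ∈ Finset.range n, b k ^ 2 * σ2 k) +
        (Real.sqrt (5 * |B₁|) + |B₂|) * N ^ (3 / 4 : ℝ) := by
    have h1 : ∑ k ∈ Finset.range n, b k * E k ≤
        ∑ k ∈ Finset.range n, |x k| + ∑ k ∈ Finset.range n, b k * |e k| := by
      rw [← Finset.sum_add_distrib]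
      refine Finset.sum_le_sum fun k _ => ?_
      have h2 := mul_le_mul_of_nonneg_left (hE k) (hb k).1
      have h3 := mul_le_of_le_one_left (abs_nonneg (x k)) (hb k).2
      linarith
    have h2 : B₂ * N ^ (3 / 4 : ℝ) ≤ |B₂| * N ^ (3 / 4 : ℝ) :=
      mul_le_mul_of_nonneg_right (le_abs_self _) (by positivity)
    linarith
  have hN2 : N ^ (3 / 4 : ℝ) ≤ 2 * (n : ℝ) ^ (3 / 4 : ℝ) := by
    calc N ^ (3 / 4 : ℝ) ≤ (2 * n : ℝ) ^ (3 / 4 : ℝ) :=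
          Real.rpow_le_rpow hN0.le (by linarith) (by norm_num)
      _ = 2 ^ (3 / 4 : ℝ) * (n : ℝ) ^ (3 / 4 : ℝ) := Real.mul_rpow (by norm_num) hn0.le
      _ ≤ 2 * (n : ℝ) ^ (3 / 4 : ℝ) := by
          gcongr
          calc (2 : ℝ) ^ (3 / 4 : ℝ) ≤ 2 ^ (1 : ℝ) :=
                Real.rpow_le_rpow_of_exponent_le (by norm_num) (by norm_num)
            _ = 2 := Real.rpow_one 2
  have e3 : (1 / (n : ℝ)) ^ (1 / 4 : ℝ) * n = (n : ℝ) ^ (3 / 4 : ℝ) := by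
    rw [one_div, Real.inv_rpow hn0.le, ← Real.rpow_neg hn0.le]
    nth_rewrite 2 [← Real.rpow_one (n : ℝ)]
    rw [← Real.rpow_add hn0]; norm_num
  have e4 : Real.sqrt ((∑ k ∈ Finset.range n, b k ^ 2 * σ2 k) / n) * n =
      Real.sqrt (n * ∑ k ∈ Finset.range n, b k ^ 2 * σ2 k) := by
    conv_lhs => rw [← Real.sqrt_sq hn0.le]
    rw [← Real.sqrt_mul' _ (by positivity), Real.sqrt_sq hn0.le]
    congr 1; field_simp
  rw [div_le_iff₀ hn0, add_mul, e4, mul_assoc, e3]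
  refine htotal.trans (add_le_add le_rfl ?_)
  have := mul_le_mul_of_nonneg_left hN2
    (show 0 ≤ Real.sqrt (5 * |B₁|) + |B₂| by positivity)
  linarith

end PredictionError

/-! ### Adaptedness and noise transforms of the algorithm. -/

section Algorithm

variable {Ω : Type*} [mΩ : MeasurableSpace Ω] {Pr : Measure Ω} {F : Filtration ℕ mΩ} {d : ℕ}
  {D : Set (Fin d → ℝ)} {θ : Fin d → ℝ} {φ : ℕ → Ω → Fin d → ℝ} {ε : ℕ → Ω → ℝ}
  {f : ℕ → Ω → ℝ → ℝ} {L l u U b : ℕ → Ω → ℝ}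

theorem measurable_observation (hφ : ∀ k, Measurable[F k] (φ k)) (hε : ∀ k, Measurable[F k] (ε k))
    (hL : ∀ k, Measurable[F k] (L k)) (hl : ∀ k, Measurable[F k] (l k))
    (hu : ∀ k, Measurable[F k] (u k)) (hU : ∀ k, Measurable[F k] (U k)) (k : ℕ) :
    Measurable[F (k + 1)] (observation L l u U φ θ ε (k + 1)) := by
  have hF : (F k : MeasurableSpace Ω) ≤ F (k + 1) := F.mono (Nat.le_succ k)
  exact measurable_saturate ((hL k).mono hF le_rfl) ((hl k).mono hF le_rfl)
    ((hu k).mono hF le_rfl) ((hU k).mono hF le_rfl)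
    (((measurable_dotProduct (hφ k) measurable_const).mono hF le_rfl).add (hε (k + 1)))

/-- Adaptedness of recursive estimates whose gains depend on the current estimate. -/
theorem measurable_of_recursion (hD : Convex ℝ D) (hDc : IsCompact D) {y : ℕ → Ω → ℝ}
    (hf : ∀ k, IsMedianZeroCondDensity Pr (F k) (ε (k + 1)) (f (k + 1)))
    (hφ : ∀ k, Measurable[F k] (φ k)) (hy : ∀ k, Measurable[F (k + 1)] (y (k + 1)))
    (hL : ∀ k, Measurable[F k] (L k)) (hl : ∀ k, Measurable[F k] (l k))
    (hu : ∀ k, Measurable[F k] (u k)) (hU : ∀ k, Measurable[F k] (U k))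
    (hb : ∀ k, Measurable[F k] (b k)) {μ : ℕ → Ω → ℝ} (hμ : IsStepParameter Pr F μ)
    {β : ℕ → Ω → ℝ} {est : ℕ → Ω → Fin d → ℝ} {P : ℕ → Ω → Matrix (Fin d) (Fin d) ℝ}
    (hβ0 : ∀ k ω, 0 ≤ β k ω) (hβ : ∀ k, Measurable[F k] (est k) → Measurable[F k] (β k))
    (hinit : IsInitialValue F D (est 0) (P 0))
    (hstep : ∀ k ω, IsRecursiveStep D (μ k ω) (β k ω) (b k ω)
      (signInnovation (f (k + 1) ω) (L k ω) (l k ω) (u k ω) (U k ω) (y (k + 1) ω)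
        (φ k ω ⬝ᵥ est k ω)) (φ k ω) (est k ω) (P k ω) (est (k + 1) ω) (P (k + 1) ω)) (k : ℕ) :
    Measurable[F k] (est k) := by
  suffices h : Measurable[F k] (est k) ∧ ∀ i j, Measurable[F k] fun ω => P k ω i j from h.1
  induction k with
  | zero => exact ⟨hinit.measurable_estimate, hinit.measurable_matrix⟩
  | succ k ih =>
    have hF : (F k : MeasurableSpace Ω) ≤ F (k + 1) := F.mono (Nat.le_succ k)
    have hpos : ∀ ω, (P k ω).PosDef := fun ω =>
      posDef_of_isRecursiveStep (P := fun k => P k ω) (hinit.posDef ω) (fun k => hμ.pos k ω)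
        (fun k => hβ0 k ω) (fun k => hstep k ω) k
    exact measurable_of_isRecursiveStep hD hDc ((hμ.adapted k).mono hF le_rfl)
      ((hβ k ih.1).mono hF le_rfl) ((hb k).mono hF le_rfl)
      ((hf k).measurable_signInnovation hF (hL k) (hl k) (hu k) (hU k)
        (measurable_dotProduct (hφ k) ih.1) (hy k))
      ((hφ k).mono hF le_rfl) (ih.1.mono hF le_rfl) (fun i j => (ih.2 i j).mono hF le_rfl)
      (hμ.pos k) (hβ0 k) hpos (hstep k)

theorem mem_of_recursion {μ β v : ℕ → Ω → ℝ} {est : ℕ → Ω → Fin d → ℝ}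
    {P : ℕ → Ω → Matrix (Fin d) (Fin d) ℝ} (hinit : IsInitialValue F D (est 0) (P 0))
    (hstep : ∀ k ω, IsRecursiveStep D (μ k ω) (β k ω) (b k ω) (v k ω) (φ k ω) (est k ω) (P k ω)
      (est (k + 1) ω) (P (k + 1) ω)) (k : ℕ) (ω : Ω) : est k ω ∈ D := by
  cases k with
  | zero => exact hinit.mem ω
  | succ k => exact (hstep k ω).2.1

/-- The martingale difference part of the innovation satisfies the self-normalized bound along
the prediction errors. -/
theorem ae_innovationNoise_transform_le [IsProbabilityMeasure Pr]
    (hf : ∀ k, IsMedianZeroCondDensity Pr (F k) (ε (k + 1)) (f (k + 1)))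
    (hφ : ∀ k, Measurable[F k] (φ k)) (hε : ∀ k, Measurable[F k] (ε k))
    (hl : ∀ k, Measurable[F k] (l k)) (hu : ∀ k, Measurable[F k] (u k))
    (hb : ∀ k, Measurable[F k] (b k)) {μ : ℕ → Ω → ℝ} (hμ : ∀ k, Measurable[F k] (μ k))
    {est : ℕ → Ω → Fin d → ℝ} (hest : ∀ k, Measurable[F k] (est k)) (θ : Fin d → ℝ) :
    ∀ᵐ ω ∂Pr, ∀ τ : ℝ, 0 < τ → ∃ B : ℝ, ∀ n : ℕ,
      ∑ k ∈ Finset.range n, -2 * (b k ω / μ k ω) * (φ k ω ⬝ᵥ θ - φ k ω ⬝ᵥ est k ω) *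
        innovationNoise (f (k + 1) ω) (l k ω) (u k ω) (φ k ω ⬝ᵥ est k ω) (φ k ω ⬝ᵥ θ)
          (ε (k + 1) ω) ≤
        τ * ∑ k ∈ Finset.range n,
          (-2 * (b k ω / μ k ω) * (φ k ω ⬝ᵥ θ - φ k ω ⬝ᵥ est k ω)) ^ 2 +
          B * (1 + Real.log (n + 1)) := by
  have hs : ∀ k, Measurable[F k] fun ω => φ k ω ⬝ᵥ est k ω := fun k =>
    measurable_dotProduct (hφ k) (hest k)
  have ht : ∀ k, Measurable[F k] fun ω => φ k ω ⬝ᵥ θ := fun k =>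
    measurable_dotProduct (hφ k) measurable_const
  exact ae_martingale_transform_le F
    (w := fun k ω => innovationNoise (f (k + 1) ω) (l k ω) (u k ω) (φ k ω ⬝ᵥ est k ω)
      (φ k ω ⬝ᵥ θ) (ε (k + 1) ω))
    (ξ := fun k ω => -2 * (b k ω / μ k ω) * (φ k ω ⬝ᵥ θ - φ k ω ⬝ᵥ est k ω)) zero_lt_two
    (fun k => (hf k).measurable_innovationNoise (F.mono (Nat.le_succ k)) (hε (k + 1)) (hl k)
      (hu k) (hs k) (ht k))
    (fun k ω => (hf k).abs_innovationNoise_le ω _ _ _ _ _)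
    (fun k => (hf k).condExp_innovationNoise (F.le k) ((hε (k + 1)).mono (F.le _) le_rfl) (hl k)
      (hu k) (hs k) (ht k))
    fun k => (((hb k).div (hμ k)).const_mul (-2)).mul ((ht k).sub (hs k))

end Algorithm

/-! ### The averaged prediction error of the two-step algorithm. -/

theorem theorem3 {Ω : Type*} [mΩ : MeasurableSpace Ω] (Pr : Measure Ω) [IsProbabilityMeasure Pr]
    (F : Filtration ℕ mΩ) {d : ℕ} (hd : 1 ≤ d)
    (D : Set (Fin d → ℝ)) (θ : Fin d → ℝ) (φ : ℕ → Ω → Fin d → ℝ)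
    (ε : ℕ → Ω → ℝ) (f : ℕ → Ω → ℝ → ℝ)
    (L l u U b c mBar m : ℕ → Ω → ℝ) (C M : ℝ)
    (hreg : RegressorConditions Pr F D θ φ c C)
    (hthr : ThresholdConditions Pr F L l u U b M)
    (hnoise : NoiseConditions Pr F ε f C M)
    (hmBar : IsStepParameter Pr F mBar) (hm : IsStepParameter Pr F m)
    (estBar : ℕ → Ω → Fin d → ℝ) (PBar : ℕ → Ω → Matrix (Fin d) (Fin d) ℝ)
    (est : ℕ → Ω → Fin d → ℝ) (P : ℕ → Ω → Matrix (Fin d) (Fin d) ℝ)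
    (halg : IsTSWLAD F D φ (observation L l u U φ θ ε) L l u U b c f mBar m estBar PBar est P)
    (hcont : ∀ᵐ ω ∂Pr, ∀ k, l k ω = L k ω ∧ u k ω = U k ω)
    (hmds : IsMartingaleDifference Pr F ε)
    (r : ℝ) (hr : 4 < r)
    (hmoment : ∀ᵐ ω ∂Pr, (⨆ k, condMoment Pr F ε r k ω) < ⊤) :
    ∀ᵐ ω ∂Pr, ∃ R : ℕ → ℝ,
      R =O[atTop] (fun n : ℕ => (Real.log (Real.log n) / n) ^ (1 / 4 : ℝ)) ∧
      ∀ n : ℕ, 1 ≤ n →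
        avgPredictionError b (observation L l u U φ θ ε) (prediction L l u U φ est) n ω ≤
          Real.sqrt ((∑ k ∈ Finset.range n, b k ω ^ 2 * noiseVariance Pr F ε k ω) / n) + R n := by
  have hθ : θ ∈ D := interior_subset hreg.interior
  have hf := hnoise.density
  have hy := measurable_observation (θ := θ) hreg.adapted hmds.adapted hthr.adapted_L
    hthr.adapted_l hthr.adapted_u hthr.adapted_U
  have hβB0 : ∀ k ω, 0 ≤ prelimBeta (f (k + 1) ω) (l k ω) (u k ω) (c k ω) := fun k ω =>
    prelimBeta_nonneg ((hf k).nonneg ω) _ _ _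
  have hβ0 : ∀ k ω, 0 ≤ accelBeta (f (k + 1) ω) (L k ω) (l k ω) (u k ω) (U k ω)
      (φ k ω ⬝ᵥ est k ω) (φ k ω ⬝ᵥ estBar k ω) := fun k ω =>
    accelBeta_nonneg ((hf k).integrable ω) ((hf k).nonneg ω) ((hf k).median ω) _ _ _ _ _ _
  have hestB := measurable_of_recursion hreg.convex hreg.compact hf hreg.adapted hy
    hthr.adapted_L hthr.adapted_l hthr.adapted_u hthr.adapted_U hthr.adapted_b hmBar hβB0
    (fun k _ => (hf k).measurable_prelimBeta (hthr.adapted_l k) (hthr.adapted_u k)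
      (hreg.adapted_bound k)) halg.initBar halg.stepBar
  have hest := measurable_of_recursion hreg.convex hreg.compact hf hreg.adapted hy
    hthr.adapted_L hthr.adapted_l hthr.adapted_u hthr.adapted_U hthr.adapted_b hm hβ0
    (fun k hk => (hf k).measurable_accelBeta (hthr.adapted_L k) (hthr.adapted_l k)
      (hthr.adapted_u k) (hthr.adapted_U k) (measurable_dotProduct (hreg.adapted k) hk)
      (measurable_dotProduct (hreg.adapted k) (hestB k))) halg.init halg.step
  have hmemB := mem_of_recursion halg.initBar halg.stepBar
  have hmem := mem_of_recursion halg.init halg.step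
  have hbabs : ∀ᵐ ω ∂Pr, ∀ k, |b k ω| ≤ 1 := by
    filter_upwards [hthr.b_lower, hthr.b_upper] with ω ⟨δ, hδ, h1⟩ h2 k
    rw [abs_of_pos (hδ.trans_le (h1 k))]
    exact h2 k
  filter_upwards [hreg.bounded, hreg.le_bound, hreg.bound_le, hthr.ordered, hthr.le_M,
    hthr.nondegenerate, hthr.b_lower, hthr.b_upper, hnoise.density_bounds, hmBar.bounds, hm.bounds,
    hcont,
    ae_innovationNoise_transform_le hf hreg.adapted hmds.adapted hthr.adapted_l hthr.adapted_u
      hthr.adapted_b hmBar.adapted hestB θ,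
    ae_innovationNoise_transform_le hf hreg.adapted hmds.adapted hthr.adapted_l hthr.adapted_u
      hthr.adapted_b hm.adapted hest θ,
    ae_sum_weighted_noise_le hmds.adapted hthr.adapted_b hbabs (by linarith) hmoment]
    with ω hφbdd hcle hcC hord hM hnd ⟨b₀, hb₀, hb₀b⟩ hb1 ⟨h, H, hh, hfb⟩ ⟨δB, BB, hδB, hmBb⟩
      ⟨δ, Bm, hδ, hmb⟩ hLU hwB hw ⟨B₂, hB₂⟩
  have hL : ∀ k, L k ω = l k ω := fun k => (hLU k).1.symm
  have hU : ∀ k, U k ω = u k ω := fun k => (hLU k).2.symm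
  -- With L = l and u = U, equality l = u would be the excluded degenerate case.
  have hlu : ∀ k, l k ω < u k ω := fun k =>
    lt_of_le_of_ne (hord k).2.1 fun e => hnd k ⟨hL k, e, (hU k).symm⟩
  have hb0 : ∀ k, 0 ≤ b k ω := fun k => hb₀.le.trans (hb₀b k)
  have hbk : ∀ k, 0 ≤ b k ω ∧ b k ω ≤ 1 := fun k => ⟨hb0 k, hb1 k⟩
  obtain ⟨Bφ, hBφ⟩ := hφbdd.exists_norm_le
  have hφi : ∀ k i, |φ k ω i| ≤ Bφ := fun k i =>
    (norm_le_pi_norm (φ k ω) i).trans (hBφ _ ⟨k, rfl⟩)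
  have hpred : ∀ k, ∀ x ∈ D, |φ k ω ⬝ᵥ x| ≤ C := fun k x hx => (hcle k x hx).trans (hcC k)
  have hrange : ∀ k c', c' ≤ C → ∀ x : ℝ,
      |x| ≤ max (2 * c') (max (c' + l k ω) (c' - u k ω)) →
        h ≤ f (k + 1) ω x ∧ f (k + 1) ω x ≤ H := by
    intro k c' hc' x hx
    refine hfb k x (hx.trans ?_)
    have h1 := hM k
    have h2 := le_max_left (l k ω) (-u k ω)
    have h3 := le_max_right (l k ω) (-u k ω)
    refine max_le (le_max_of_le_left (by linarith)) (le_max_of_le_right (max_le ?_ ?_)) <;>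
      linarith
  have hc0 : ∀ k, 0 ≤ c k ω := fun k => (abs_nonneg _).trans (hcle k θ hθ)
  have hv : ∀ (e : ℕ → Ω → Fin d → ℝ) (k : ℕ), signInnovation (f (k + 1) ω) (L k ω) (l k ω)
      (u k ω) (U k ω) (observation L l u U φ θ ε (k + 1) ω) (φ k ω ⬝ᵥ e k ω) =
        innovationMean (f (k + 1) ω) (l k ω) (u k ω) (φ k ω ⬝ᵥ e k ω) (φ k ω ⬝ᵥ θ) +
        innovationNoise (f (k + 1) ω) (l k ω) (u k ω) (φ k ω ⬝ᵥ e k ω) (φ k ω ⬝ᵥ θ)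
          (ε (k + 1) ω) := by
    intro e k
    rw [← signInnovation_eq (hlu k), observation, hL, hU]
  have hprelim : ∀ k, h ≤ prelimBeta (f (k + 1) ω) (l k ω) (u k ω) (c k ω) ∧
      prelimBeta (f (k + 1) ω) (l k ω) (u k ω) (c k ω) ≤ H := fun k => by
    have hzero : |(0 : ℝ)| ≤ max (2 * c k ω) (max (c k ω + l k ω) (c k ω - u k ω)) := by
      rw [abs_zero]; exact le_max_of_le_left (by linarith [hc0 k])
    exact ⟨le_prelimBeta (hc0 k) fun x hx => (hrange k _ (hcC k) x hx).1,
      (prelimBeta_le ((hf k).nonneg ω) hzero).trans (hrange k _ (hcC k) 0 hzero).2⟩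
  -- The preliminary drift contracts outright, so the error sequence is zero.
  obtain ⟨K₀, hK₀⟩ := exists_sum_sq_le_log (θ := θ) (m := fun k => mBar k ω)
    (b := fun k => b k ω) (φ := fun k => φ k ω) (ϑ := fun k => estBar k ω)
    (P := fun k => PBar k ω) (halg.initBar.posDef ω) hreg.convex hθ (fun k => hβB0 k ω)
    (fun k => halg.stepBar k ω) hδB hmBb hh hprelim hbk hφi
    (fun k => abs_signInnovation_le ((hf k).integrable ω) ((hf k).nonneg ω)
      ((hf k).integral_eq_one ω) _ _ _ _ _ _) (hv estBar) (mul_pos hb₀ hh) le_rfl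
    (e := fun _ => 0) (Be := 0) (by simp) (fun _ => le_rfl)
    (fun k => by
      simpa using prelim_drift_le ((hf k).integrable ω) ((hf k).nonneg ω) ((hf k).median ω)
        (hcle k _ (hmemB k ω)) (hcle k _ hθ) (hb₀b k) (hb0 k) (hb1 k) hh.le (hprelim k).1) hwB
  have haccel : ∀ k, h ≤ accelBeta (f (k + 1) ω) (L k ω) (l k ω) (u k ω) (U k ω)
      (φ k ω ⬝ᵥ est k ω) (φ k ω ⬝ᵥ estBar k ω) ∧ accelBeta (f (k + 1) ω) (L k ω) (l k ω) (u k ω)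
        (U k ω) (φ k ω ⬝ᵥ est k ω) (φ k ω ⬝ᵥ estBar k ω) ≤ 2 * H := fun k => by
    rw [hL, hU]
    exact accelBeta_bounds ((hf k).integrable ω) ((hf k).nonneg ω) ((hf k).median ω) (hlu k)
      (hpred k _ (hmem k ω)) (hpred k _ (hmemB k ω)) hh.le (hrange k C le_rfl)
  -- The error sequence is now the squared preliminary prediction error, whose sums are logarithmic
  -- by the first application.
  obtain ⟨K₁, hK₁⟩ := exists_sum_sq_le_log (θ := θ) (m := fun k => m k ω)
    (b := fun k => b k ω) (φ := fun k => φ k ω) (ϑ := fun k => est k ω)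
    (P := fun k => P k ω) (halg.init.posDef ω) hreg.convex hθ (fun k => hβ0 k ω)
    (fun k => halg.step k ω) hδ hmb hh haccel hbk hφi
    (fun k => abs_signInnovation_le ((hf k).integrable ω) ((hf k).nonneg ω)
      ((hf k).integral_eq_one ω) _ _ _ _ _ _) (hv est)
    (show 0 < b₀ * h / 2 by positivity) (show 0 ≤ 32 * H ^ 2 / h by positivity)
    (e := fun k => (φ k ω ⬝ᵥ θ - φ k ω ⬝ᵥ estBar k ω) ^ 2) hK₀ (fun _ => sq_nonneg _)
    (fun k => by
      rw [hL, hU]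
      exact accel_drift_le ((hf k).integrable ω) ((hf k).nonneg ω) ((hf k).median ω) (hlu k)
        (hpred k _ (hmem k ω)) (hpred k _ (hmemB k ω)) (hpred k _ hθ) (hb₀b k) (hb0 k) (hb1 k) hh
        (hrange k C le_rfl)) hw
  have hE : ∀ k, |observation L l u U φ θ ε (k + 1) ω - prediction L l u U φ est (k + 1) ω| ≤
      |φ k ω ⬝ᵥ θ - φ k ω ⬝ᵥ est k ω| + |ε (k + 1) ω| := by
    intro k
    rw [observation, prediction, hL, hU]
    refine (abs_saturate_clamp_sub_le (hlu k).le _ _).trans ?_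
    rw [add_sub_right_comm]
    exact abs_add_le _ _
  obtain ⟨K, hK⟩ := avg_abs_le_of_sum_bounds hbk
    (σ2 := fun k => noiseVariance Pr F ε k ω) (fun k => ENNReal.toReal_nonneg) hE hK₁
    (e := fun k => ε (k + 1) ω) (B₂ := B₂) (fun n => by
      simpa only [abs_of_nonneg (hb0 _)] using hB₂ n)
  exact ⟨fun n => K * (1 / (n : ℝ)) ^ (1 / 4 : ℝ), isBigO_inv_rpow_loglog K, hK⟩
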